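/- Let $\mathcal M_1(\mathbb R)$ be the space of Borel probability measures on $\mathbb R$, and let $\mathbb P$, with expectation $\mathbb E$, be a probability measure on the space $\mathcal M_1(\mathbb R)^{\mathbb Z_+}$ of sequences $\{F_j\}_{j\in\mathbb Z_+}$ (environments) that is stationary and ergodic under the shift $\{F_j\}\mapsto\{F_{j+1}\}$. We write $F_j(u)=F_j((-\infty,u])$ for distribution functions. On a probability space $(\Omega,\mathcal F,\mathbf P)$, with expectation $\mathbf E$, let $\{F_j\}$ have law $\mathbb P$ and, given $\{F_j\}$, let the real-valued weights $\{X(i,j):(i,j)\in\mathbb Z_+^2\}$ be independent with $X(i,j)\sim F_j$. For $z\in\mathbb Z_+^2$ let $$T(z)=\max_{\pi}\sum_{z'\in\pi,\;z'\ne z}X(z'),$$ where $\pi$ ranges over the lattice paths from $(0,0)$ to $z$ with steps $(1,0)$ and $(0,1)$ (the starting point is included, the endpoint $z$ is excluded). Assume that $$\mathbf E|X(z)|<\infty,\qquad \int_0^\infty\bigl\{1-\mathbb E(F_0(u))\bigr\}^{1/2}\,du<\infty,\qquad \int_0^\infty \operatorname*{ess\,sup}_{\mathbb P}\,(1-F_0(u))\,du<\infty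 .$$ Then there is a deterministic function $\Psi:(0,\infty)^2\to\mathbb R$ such that for all $x,y>0$ the random variables $T(\lfloor nx\rfloor,\lfloor ny\rfloor)$ are integrable and $$\Psi(x,y)=\lim_{n\to\infty}\frac1n\,T(\lfloor nx\rfloor,\lfloor ny\rfloor)\qquad \mathbf P\text{-almost surely and in }L^1(\mathbf P).$$ Moreover $\Psi$ is homogeneous ($\Psi(cx,cy)=c\,\Psi(x,y)$ for all $c,x,y>0$), concave and continuous on $(0,\infty)^2$. -/

import Mathlib

open MeasureTheory ProbabilityTheory Filter Topology

noncomputable section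

namespace LastPassage

/-- `p` is a (weakly) nondecreasing nearest-neighbour path in `ℤ₊²` from `z₁` to `z₂`, listed as
`z₁, …, z₂`: each step increases exactly one of the two coordinates by one. -/
def IsPath (z₁ z₂ : ℕ × ℕ) (p : List (ℕ × ℕ)) : Prop :=
  p.head? = some z₁ ∧ p.getLast? = some z₂ ∧
    p.IsChain (fun a b => b = (a.1 + 1, a.2) ∨ b = (a.1, a.2 + 1))

/-- The total weight collected by a path; the first point is included, the last one excluded. -/
def pathWeight (w : ℕ × ℕ → ℝ) (p : List (ℕ × ℕ)) : ℝ :=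
  (p.dropLast.map w).sum

/-- The last-passage time `T(z₁, z₂)` for the weights `w`: the maximal weight of a nondecreasing
path from `z₁` to `z₂`, the endpoint `z₂` being excluded. For `z₁ ≤ z₂` the supremum is a maximum,
see `isGreatest_passageTime`. -/
def passageTime (w : ℕ × ℕ → ℝ) (z₁ z₂ : ℕ × ℕ) : ℝ :=
  sSup {s : ℝ | ∃ p, IsPath z₁ z₂ p ∧ s = pathWeight w p}

theorem finite_isPath (z₁ z₂ : ℕ × ℕ) : {p | IsPath z₁ z₂ p}.Finite := by
  suffices H : ∀ (d : ℕ) (a : ℕ × ℕ), z₂.1 + z₂.2 - (a.1 + a.2) ≤ d →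
      {p | IsPath a z₂ p}.Finite from H _ z₁ le_rfl
  have mono : ∀ (p : List (ℕ × ℕ)) (a : ℕ × ℕ), IsPath a z₂ p → a.1 + a.2 ≤ z₂.1 + z₂.2 := by
    intro p
    induction p with
    | nil => rintro a ⟨h, -, -⟩; simp at h
    | cons b t ih =>
      rintro a ⟨h1, h2, h3⟩
      obtain rfl : b = a := by simpa using h1
      cases t with
      | nil =>
        obtain rfl : b = z₂ := by simpa using h2
        exact le_rfl
      | cons c t =>
        rw [List.isChain_cons_cons] at h3
        have := ih c ⟨rfl, by simpa using h2, h3.2⟩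
        rcases h3.1 with rfl | rfl <;> simp at this <;> omega
  intro d
  induction d with
  | zero =>
    intro a ha
    refine (Set.finite_singleton [a]).subset ?_
    rintro (_ | ⟨b, _ | ⟨c, t⟩⟩) ⟨h1, h2, h3⟩
    · simp at h1
    · simpa using h1
    · obtain rfl : b = a := by simpa using h1
      rw [List.isChain_cons_cons] at h3
      have := mono (c :: t) c ⟨rfl, by simpa using h2, h3.2⟩
      rcases h3.1 with rfl | rfl <;> simp at this <;> omega
  | succ d ih =>
    intro a ha
    refine (((Set.finite_singleton [a]).union
      ((ih (a.1 + 1, a.2) (by simp; omega)).image (List.cons a))).union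
      ((ih (a.1, a.2 + 1) (by simp; omega)).image (List.cons a))).subset ?_
    rintro (_ | ⟨b, _ | ⟨c, t⟩⟩) ⟨h1, h2, h3⟩
    · simp at h1
    · exact Or.inl (Or.inl (by simpa using h1))
    · obtain rfl : b = a := by simpa using h1
      rw [List.isChain_cons_cons] at h3
      rcases h3.1 with rfl | rfl
      · exact Or.inl (Or.inr ⟨_, ⟨rfl, by simpa using h2, h3.2⟩, rfl⟩)
      · exact Or.inr ⟨_, ⟨rfl, by simpa using h2, h3.2⟩, rfl⟩

theorem exists_isPath {z₁ z₂ : ℕ × ℕ} (h : z₁ ≤ z₂) : ∃ p, IsPath z₁ z₂ p := by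
  suffices H : ∀ (d : ℕ) (a : ℕ × ℕ), a ≤ z₂ → z₂.1 + z₂.2 = a.1 + a.2 + d →
      ∃ p, IsPath a z₂ p by
    refine H (z₂.1 + z₂.2 - (z₁.1 + z₁.2)) z₁ h ?_
    have := h.1
    have := h.2
    omega
  intro d
  induction d with
  | zero =>
    intro a ha hd
    obtain rfl : a = z₂ := by
      have := ha.1
      have := ha.2
      ext <;> omega
    exact ⟨[a], rfl, rfl, by simp⟩
  | succ d ih =>
    intro a ha hd
    have h1 := ha.1
    have h2 := ha.2
    have step : ∀ b, (b = (a.1 + 1, a.2) ∨ b = (a.1, a.2 + 1)) → b ≤ z₂ →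
        z₂.1 + z₂.2 = b.1 + b.2 + d → ∃ p, IsPath a z₂ p := by
      intro b hb hle hbd
      obtain ⟨p, hp1, hp2, hp3⟩ := ih b hle hbd
      cases p with
      | nil => simp at hp1
      | cons c t =>
        obtain rfl : c = b := by simpa using hp1
        exact ⟨a :: c :: t, rfl, by simpa using hp2, List.isChain_cons_cons.2 ⟨hb, hp3⟩⟩
    by_cases h3 : a.1 < z₂.1
    · exact step (a.1 + 1, a.2) (Or.inl rfl) ⟨h3, h2⟩ (by simp; omega)
    · exact step (a.1, a.2 + 1) (Or.inr rfl) ⟨h1, by simp; omega⟩ (by simp; omega)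

theorem isGreatest_passageTime (w : ℕ × ℕ → ℝ) {z₁ z₂ : ℕ × ℕ} (h : z₁ ≤ z₂) :
    IsGreatest {s : ℝ | ∃ p, IsPath z₁ z₂ p ∧ s = pathWeight w p} (passageTime w z₁ z₂) := by
  have hfin : {s : ℝ | ∃ p, IsPath z₁ z₂ p ∧ s = pathWeight w p}.Finite := by
    refine ((finite_isPath z₁ z₂).image (pathWeight w)).subset ?_
    rintro s ⟨p, hp, rfl⟩
    exact ⟨p, hp, rfl⟩
  obtain ⟨p, hp⟩ := exists_isPath h
  exact ⟨Set.Nonempty.csSup_mem ⟨_, p, hp, rfl⟩ hfin, fun s hs => le_csSup hfin.bddAbove hs⟩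

/-- An environment: a sequence of Borel probability distributions on `ℝ`, one for each row. -/
abbrev Env : Type := ℕ → ProbabilityMeasure ℝ

/-- The shift `(F_j)_j ↦ (F_{j+1})_j` on environments. -/
def shift (F : Env) : Env := fun j => F (j + 1)

/-- The last-passage model with environment law `P`, realised on a probability space `(Ω, μ)`:
the environment `F` has law `P` and, given `F`, the weights `X (i, j)` are independent with
`X (i, j) ∼ F j`. -/
structure IsModel (P : Measure Env) {Ω : Type*} [MeasurableSpace Ω] (μ : Measure Ω)
    (F : Ω → Env) (X : ℕ × ℕ → Ω → ℝ) : Prop where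
  measurable_env : Measurable F
  measurable_weight : ∀ z, Measurable (X z)
  map_env : μ.map F = P
  /-- Conditional independence given the environment, with the prescribed marginals: the
  conditional probability of `{X z ∈ B z for all z ∈ s}` given the environment is the product of
  the numbers `F_j (B (i, j))`, `(i, j) ∈ s`. -/
  weight_law : ∀ (A : Set Env), MeasurableSet A → ∀ (s : Finset (ℕ × ℕ)) (B : ℕ × ℕ → Set ℝ),
    (∀ z, MeasurableSet (B z)) →
      μ {ω | F ω ∈ A ∧ ∀ z ∈ s, X z ω ∈ B z} =
        ∫⁻ ω in F ⁻¹' A, ∏ z ∈ s, (F ω z.2 : Measure ℝ) (B z) ∂μ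

end LastPassage

end

/-!
The law of large numbers for last-passage percolation in a stationary ergodic environment.

Everything is done for the law `weightLaw P` of the weights on `ℕ × ℕ → ℝ`, and for the
last-passage times `lpp` defined by dynamic programming, which agree with `passageTime`
(`passageTime_eq_lpp`). Three properties of the law are used: it is invariant under the translations
of the quadrant and trivial on events invariant under both unit translations (`IsErgodicField`), the
weights are integrable, and large weights have a uniformly small effect on the mean last-passage
times (`HasSmallExcess`).

*Ergodicity.* Given the environment, the columns of weights are independent and identically
distributed, so by Kolmogorov's zero-one law an event invariant under the horizontal translation has
conditional probability zero or one; by ergodicity of the environment this conditional probability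
is constant if the event is invariant under the vertical translation too
(`isErgodicField_weightLaw`).

*Small excess.* By the layer-cake formula it suffices to bound the mean last-passage time of the
indicators of the points with weight above a level `v`. The number of chains of such points is at
least `2 ^ lpp`, and its mean given the environment is computed and bounded by recursion
(`genSum_chains_le`). With `q v` the mean and `b v` the essential supremum of `1 - F₀ v`, this gives
a bound of the order of `(i + j + 1) * (2 * b v + √(q v))`, and the two tail conditions say that
this is integrable in `v` (`hasSmallExcess_weightLaw`).

*Convergence.* Fekete's lemma gives the growth rate `γ` of the means along a ray. The points
`(⌊n x⌋, ⌊n y⌋)` are additive in `n` only up to an error of one in each coordinate, which costs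
boundedly many weights and is negligible by Borel-Cantelli. Because of the zero-one laws for the
upper and lower growth rates, no general subadditive ergodic theorem is needed. If the upper rate is
at least `c`, a long path can be cut into short blocks of slope almost `c` and few exceptional steps
(`superadditive_block_bound`), so `c ≤ γ`. The upper bound, the small excess and the convergence of
the means together give convergence in `L¹`. Finally, by convergence in `L¹`, long blocks fall short
of slope `γ` by little in mean; a maximal inequality for the total shortfall
(`measure_forall_sum_lt_ne_zero`) bounds the lower rate from below with positive probability, hence
almost surely.

Homogeneity and concavity of the limit are read off from the means, which are superadditive and
change boundedly between points at bounded distance; continuity follows from concavity.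
-/

namespace LastPassage

/-! ### The last-passage recursion -/

/-- The last-passage time from the origin to `(i, j)`, defined by dynamic programming on the last
step of the path; see `passageTime_eq_lpp`. -/
def lpp (w : ℕ × ℕ → ℝ) : ℕ → ℕ → ℝ
  | 0, 0 => 0
  | i + 1, 0 => lpp w i 0 + w (i, 0)
  | 0, j + 1 => lpp w 0 j + w (0, j)
  | i + 1, j + 1 => max (lpp w i (j + 1) + w (i, j + 1)) (lpp w (i + 1) j + w (i + 1, j))

/-- The weights seen from the point `(a, b)`. -/
def translate (a b : ℕ) (w : ℕ × ℕ → ℝ) : ℕ × ℕ → ℝ := fun z => w (a + z.1, b + z.2)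

theorem translate_translate (a b c d : ℕ) (w : ℕ × ℕ → ℝ) :
    translate a b (translate c d w) = translate (c + a) (d + b) w := by
  funext z
  simp [translate, add_assoc]

@[simp]
theorem translate_zero (w : ℕ × ℕ → ℝ) : translate 0 0 w = w := by
  funext z
  simp [translate]

@[simp]
theorem lpp_zero_zero (w : ℕ × ℕ → ℝ) : lpp w 0 0 = 0 := by simp [lpp]

theorem lpp_step_right (w : ℕ × ℕ → ℝ) (i j : ℕ) : lpp w i j + w (i, j) ≤ lpp w (i + 1) j := by
  cases j with
  | zero => simp [lpp]
  | succ j => rw [lpp]; exact le_max_left _ _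

theorem lpp_step_up (w : ℕ × ℕ → ℝ) (i j : ℕ) : lpp w i j + w (i, j) ≤ lpp w i (j + 1) := by
  cases i with
  | zero => simp [lpp]
  | succ i => rw [lpp]; exact le_max_right _ _

/-- Induction along the last-passage recursion: a property of the value at a point follows from
the property at one of the admissible predecessors with the predecessor's weight added. -/
theorem lpp_induction {w : ℕ × ℕ → ℝ} {Q : ℕ → ℕ → ℝ → Prop} (h0 : Q 0 0 0)
    (hr : ∀ i j, Q i j (lpp w i j) → Q (i + 1) j (lpp w i j + w (i, j)))
    (hu : ∀ i j, Q i j (lpp w i j) → Q i (j + 1) (lpp w i j + w (i, j))) :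
    ∀ i j, Q i j (lpp w i j) := by
  intro i
  induction i with
  | zero =>
    intro j
    induction j with
    | zero => simpa using h0
    | succ j ih => simpa [lpp] using hu 0 j ih
  | succ i ihi =>
    intro j
    induction j with
    | zero => simpa [lpp] using hr i 0 (ihi 0)
    | succ j ih =>
      rw [lpp]
      rcases max_choice (lpp w i (j + 1) + w (i, j + 1)) (lpp w (i + 1) j + w (i + 1, j))
        with h | h <;> rw [h]
      · exact hr i (j + 1) (ihi (j + 1))
      · exact hu (i + 1) j ih

theorem exists_isPath_pathWeight_eq_lpp (w : ℕ × ℕ → ℝ) (i j : ℕ) :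
    ∃ p, IsPath (0, 0) (i, j) p ∧ lpp w i j = pathWeight w p := by
  have snoc : ∀ (z z' : ℕ × ℕ) (t : ℝ), (z' = (z.1 + 1, z.2) ∨ z' = (z.1, z.2 + 1)) →
      (∃ p, IsPath (0, 0) z p ∧ t = pathWeight w p) →
      ∃ p, IsPath (0, 0) z' p ∧ t + w z = pathWeight w p := by
    rintro z z' _ hz ⟨p, ⟨h1, h2, h3⟩, rfl⟩
    refine ⟨p ++ [z'], ⟨?_, by simp, ?_⟩, ?_⟩
    · cases p with
      | nil => simp at h1
      | cons a t => simpa using h1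
    · rw [List.isChain_append]
      refine ⟨h3, by simp, ?_⟩
      intro x hx y hy
      rw [h2] at hx
      obtain rfl : z = x := by simpa using hx
      obtain rfl : z' = y := by simpa using hy
      exact hz
    · have hne : p ≠ [] := by rintro rfl; simp at h1
      have hp : p.dropLast ++ [z] = p := by
        have := List.dropLast_append_getLast hne
        rw [List.getLast?_eq_some_getLast hne] at h2
        rwa [Option.some.inj h2] at this
      conv_rhs => rw [pathWeight, List.dropLast_concat, ← hp]
      simp [pathWeight]
  refine lpp_induction (w := w)
    (Q := fun i j t => ∃ p, IsPath (0, 0) (i, j) p ∧ t = pathWeight w p)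
    ⟨[(0, 0)], ⟨rfl, rfl, by simp⟩, by simp [pathWeight]⟩ ?_ ?_ i j
  · intro i j h
    exact snoc (i, j) (i + 1, j) _ (Or.inl rfl) h
  · intro i j h
    exact snoc (i, j) (i, j + 1) _ (Or.inr rfl) h

theorem pathWeight_le_lpp (w : ℕ × ℕ → ℝ) (p : List (ℕ × ℕ)) :
    ∀ i j, IsPath (0, 0) (i, j) p → pathWeight w p ≤ lpp w i j := by
  induction p using List.reverseRecOn with
  | nil => rintro i j ⟨h, -, -⟩; simp at h
  | append_singleton q z ih =>
    rintro i j ⟨h1, h2, h3⟩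
    obtain rfl : z = (i, j) := by simpa using h2
    rcases List.eq_nil_or_concat' q with rfl | ⟨r, y, rfl⟩
    · obtain ⟨rfl, rfl⟩ : i = 0 ∧ j = 0 := by simpa using h1
      simp [pathWeight]
    · have hy := ih y.1 y.2 ⟨by cases r <;> simpa using h1, by simp,
        (List.isChain_append.1 h3).1⟩
      have hw : pathWeight w (r ++ [y] ++ [(i, j)]) = pathWeight w (r ++ [y]) + w y := by
        simp only [pathWeight, List.dropLast_concat]
        simp
      have hstep := (List.isChain_append.1 h3).2.2 y (by simp) (i, j) (by simp)
      rw [hw]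
      rcases hstep with h | h
      · obtain ⟨rfl, rfl⟩ := Prod.mk.inj h
        linarith [lpp_step_right w y.1 y.2]
      · obtain ⟨rfl, rfl⟩ := Prod.mk.inj h
        linarith [lpp_step_up w y.1 y.2]

theorem passageTime_eq_lpp (w : ℕ × ℕ → ℝ) (i j : ℕ) :
    passageTime w (0, 0) (i, j) = lpp w i j := by
  obtain ⟨⟨p, hp, hpw⟩, hmax⟩ :=
    isGreatest_passageTime w (z₁ := (0, 0)) (z₂ := (i, j)) ⟨Nat.zero_le _, Nat.zero_le _⟩
  refine le_antisymm ?_ (hmax (exists_isPath_pathWeight_eq_lpp w i j))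
  rw [hpw]
  exact pathWeight_le_lpp w p i j hp

/-! ### Deterministic inequalities -/

theorem lpp_add_le (w : ℕ × ℕ → ℝ) (a b i j : ℕ) :
    lpp w a b + lpp (translate a b w) i j ≤ lpp w (a + i) (b + j) := by
  refine lpp_induction (w := translate a b w)
    (Q := fun i j t => lpp w a b + t ≤ lpp w (a + i) (b + j)) (by simp) ?_ ?_ i j
  · intro i j h
    have := lpp_step_right w (a + i) (b + j)
    simp only [translate, ← add_assoc] at *
    linarith
  · intro i j h
    have := lpp_step_up w (a + i) (b + j)
    simp only [translate, ← add_assoc] at *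
    linarith

theorem lpp_le_lpp_add (w v : ℕ × ℕ → ℝ) {u : ℕ × ℕ → ℝ} (h : ∀ z, w z ≤ v z + u z) (i j : ℕ) :
    lpp w i j ≤ lpp v i j + lpp u i j := by
  refine lpp_induction (w := w)
    (Q := fun i j t => t ≤ lpp v i j + lpp u i j) (by simp) ?_ ?_ i j
  · intro i j hij
    linarith [lpp_step_right v i j, lpp_step_right u i j, h (i, j)]
  · intro i j hij
    linarith [lpp_step_up v i j, lpp_step_up u i j, h (i, j)]

theorem lpp_le_of_le {w : ℕ × ℕ → ℝ} {K : ℝ} (h : ∀ z, w z ≤ K) (i j : ℕ) :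
    lpp w i j ≤ K * (i + j) := by
  refine lpp_induction (w := w) (Q := fun i j t => t ≤ K * (i + j)) (by simp) ?_ ?_ i j
  · intro i j hij
    push_cast
    linarith [h (i, j)]
  · intro i j hij
    push_cast
    linarith [h (i, j)]

theorem lpp_nonneg {w : ℕ × ℕ → ℝ} (h : ∀ z, 0 ≤ w z) (i j : ℕ) : 0 ≤ lpp w i j :=
  lpp_induction (w := w) (Q := fun _ _ t => 0 ≤ t) le_rfl
    (fun _ _ hij => add_nonneg hij (h _)) (fun _ _ hij => add_nonneg hij (h _)) i j

theorem measurable_translate (a b : ℕ) : Measurable (translate a b) :=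
  measurable_pi_lambda _ fun _ => measurable_pi_apply _

theorem measurable_lpp (i j : ℕ) : Measurable fun w : ℕ × ℕ → ℝ => lpp w i j := by
  induction i generalizing j with
  | zero =>
    induction j with
    | zero => simp
    | succ j ih => simp only [lpp]; exact ih.add (measurable_pi_apply _)
  | succ i ihi =>
    induction j with
    | zero => simp only [lpp]; exact (ihi 0).add (measurable_pi_apply _)
    | succ j ih =>
      simp only [lpp]
      exact ((ihi _).add (measurable_pi_apply _)).max (ih.add (measurable_pi_apply _))

/-- Integrability of every weight passes to all last-passage times. -/
theorem integrable_lpp {ν : Measure (ℕ × ℕ → ℝ)} (h : ∀ z, Integrable (fun w => w z) ν)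
    (i j : ℕ) : Integrable (fun w => lpp w i j) ν := by
  induction i generalizing j with
  | zero =>
    induction j with
    | zero => simp
    | succ j ih => simp only [lpp]; exact ih.add (h _)
  | succ i ihi =>
    induction j with
    | zero => simp only [lpp]; exact (ihi 0).add (h _)
    | succ j ih =>
      simp only [lpp]
      exact ((ihi _).add (h _)).sup (ih.add (h _))

/-- The sum of the absolute values of the weights in a `K × K` box at the origin. -/
def boxSum (K : ℕ) (w : ℕ × ℕ → ℝ) : ℝ := ∑ z ∈ Finset.range K ×ˢ Finset.range K, |w z|

theorem boxSum_nonneg (K : ℕ) (w : ℕ × ℕ → ℝ) : 0 ≤ boxSum K w :=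
  Finset.sum_nonneg fun _ _ => abs_nonneg _

theorem measurable_boxSum (K : ℕ) : Measurable (boxSum K) :=
  Finset.measurable_sum _ fun z _ => (measurable_pi_apply z).abs

/-- Following a path that goes right and then up gives a lower bound for the last-passage time to
a point of the `K × K` box. -/
theorem neg_boxSum_le_lpp (w : ℕ × ℕ → ℝ) {K i j : ℕ} (hi : i < K) (hj : j < K) :
    -(2 * boxSum K w) ≤ lpp w i j := by
  have h1 : ∀ i, -(∑ k ∈ Finset.range i, |w (k, 0)|) ≤ lpp w i 0 := by
    intro i
    induction i with
    | zero => simp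
    | succ i ih =>
      rw [Finset.sum_range_succ]
      linarith [lpp_step_right w i 0, neg_abs_le (w (i, 0))]
  have h2 : ∀ j, lpp w i 0 - (∑ k ∈ Finset.range j, |w (i, k)|) ≤ lpp w i j := by
    intro j
    induction j with
    | zero => simp
    | succ j ih =>
      rw [Finset.sum_range_succ]
      linarith [lpp_step_up w i j, neg_abs_le (w (i, j))]
  have h3 : ∑ k ∈ Finset.range i, |w (k, 0)| ≤ boxSum K w := by
    rw [boxSum, Finset.sum_product_right]
    refine le_trans ?_ (Finset.single_le_sum
      (f := fun y => ∑ x ∈ Finset.range K, |w (x, y)|) (a := 0)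
      (fun _ _ => Finset.sum_nonneg fun _ _ => abs_nonneg _) (Finset.mem_range.2 (by omega)))
    exact Finset.sum_le_sum_of_subset_of_nonneg (Finset.range_mono hi.le) fun _ _ _ => abs_nonneg _
  have h4 : ∑ k ∈ Finset.range j, |w (i, k)| ≤ boxSum K w := by
    rw [boxSum, Finset.sum_product]
    refine le_trans ?_ (Finset.single_le_sum
      (f := fun x => ∑ y ∈ Finset.range K, |w (x, y)|) (a := i)
      (fun _ _ => Finset.sum_nonneg fun _ _ => abs_nonneg _) (Finset.mem_range.2 hi))
    exact Finset.sum_le_sum_of_subset_of_nonneg (Finset.range_mono hj.le) fun _ _ _ => abs_nonneg _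
  linarith [h1 i, h2 j]

theorem lpp_sub_boxSum_le (w : ℕ × ℕ → ℝ) {K a b i j : ℕ} (hai : a ≤ i) (hbj : b ≤ j)
    (hi : i < a + K) (hj : j < b + K) :
    lpp w a b - 2 * boxSum K (translate a b w) ≤ lpp w i j := by
  have h1 := lpp_add_le w a b (i - a) (j - b)
  have h2 := neg_boxSum_le_lpp (translate a b w) (K := K) (i := i - a) (j := j - b)
    (by omega) (by omega)
  rw [Nat.add_sub_cancel' hai, Nat.add_sub_cancel' hbj] at h1
  linarith

/-- Layer-cake bound: writing the excess of each weight over `K` as the integral of the indicators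
of the levels above `K`, and interchanging maximum and integral. -/
theorem ofReal_lpp_excess_le_lintegral (w : ℕ × ℕ → ℝ) (K : ℝ) (i j : ℕ) :
    ENNReal.ofReal (lpp (fun z => max (w z - K) 0) i j) ≤
      ∫⁻ u in Set.Ioi K, ENNReal.ofReal (lpp (fun z => if u < w z then 1 else 0) i j) := by
  have hw : ∀ z, 0 ≤ max (w z - K) 0 := fun z => le_max_right _ _
  have key : ∀ z, ENNReal.ofReal (max (w z - K) 0) =
      ∫⁻ u in Set.Ioi K, ENNReal.ofReal (if u < w z then 1 else 0) := by
    intro z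
    have : (fun u : ℝ => ENNReal.ofReal (if u < w z then 1 else 0)) =
        (Set.Iio (w z)).indicator 1 := by
      funext u
      by_cases h : u < w z <;> simp [h]
    rw [this, lintegral_indicator_one measurableSet_Iio, Measure.restrict_apply measurableSet_Iio,
      Set.Iio_inter_Ioi, Real.volume_Ioo]
    rcases le_total (w z - K) 0 with h | h
    · rw [max_eq_right h, ENNReal.ofReal_of_nonpos h, ENNReal.ofReal_zero]
    · rw [max_eq_left h]
  have hB : ∀ (u : ℝ) (z : ℕ × ℕ), 0 ≤ (if u < w z then (1 : ℝ) else 0) := by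
    intro u z
    split_ifs <;> norm_num
  have hm : ∀ z, Measurable fun u : ℝ => ENNReal.ofReal (if u < w z then 1 else 0) := fun z =>
    (Measurable.ite measurableSet_Iio measurable_const measurable_const).ennreal_ofReal
  have hstep : ∀ i j i' j', (∀ u : ℕ × ℕ → ℝ, lpp u i j + u (i, j) ≤ lpp u i' j') →
      ENNReal.ofReal (lpp (fun z => max (w z - K) 0) i j) ≤
        ∫⁻ u in Set.Ioi K, ENNReal.ofReal (lpp (fun z => if u < w z then 1 else 0) i j) →
      ENNReal.ofReal (lpp (fun z => max (w z - K) 0) i j + max (w (i, j) - K) 0) ≤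
        ∫⁻ u in Set.Ioi K, ENNReal.ofReal (lpp (fun z => if u < w z then 1 else 0) i' j') := by
    intro i j i' j' h h'
    rw [ENNReal.ofReal_add (lpp_nonneg hw i j) (hw _)]
    refine (add_le_add h' (key (i, j)).le).trans ?_
    rw [← lintegral_add_right _ (hm (i, j))]
    refine lintegral_mono fun u => ?_
    dsimp only
    rw [← ENNReal.ofReal_add (lpp_nonneg (hB u) i j) (hB u _)]
    exact ENNReal.ofReal_le_ofReal (h _)
  exact lpp_induction (w := fun z => max (w z - K) 0) (Q := fun i j t => ENNReal.ofReal t ≤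
    ∫⁻ u in Set.Ioi K, ENNReal.ofReal (lpp (fun z => if u < w z then 1 else 0) i j))
    (by simp) (fun i j => hstep i j _ _ fun u => lpp_step_right u i j)
    (fun i j => hstep i j _ _ fun u => lpp_step_up u i j) i j

/-- Cutting `[0, M)` into good blocks of length at most `N`, on which a superadditive array `a`
is at least `c` times the length, and single steps. A single step is taken at a bad time, or when
the good block starting there would go beyond `M`. -/
theorem superadditive_block_bound {a : ℕ → ℕ → ℝ} (ha0 : ∀ k, 0 ≤ a k k)
    (ha : ∀ k m n, k ≤ m → m ≤ n → a k m + a m n ≤ a k n)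
    {D : ℕ → ℝ} (hD : ∀ k, 0 ≤ D k) (hstep : ∀ k, -D k ≤ a k (k + 1)) {bad : Set ℕ}
    {N : ℕ} {c : ℝ} (hgood : ∀ k, k ∉ bad → ∃ n, 1 ≤ n ∧ n ≤ N ∧ n * c ≤ a k (k + n)) (M : ℕ) :
    M * c - ∑ k ∈ Finset.range M, bad.indicator (fun k => D k + |c|) k
      - ∑ k ∈ Finset.Ico (M - N) M, (D k + |c|) ≤ a 0 M := by
  classical
  have hE : ∀ k, 0 ≤ D k + |c| := fun k => add_nonneg (hD k) (abs_nonneg c)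
  -- The cost of a single step starting at time `k`.
  let G : ℕ → ℝ := fun k => bad.indicator (fun k => D k + |c|) k +
    (if M - N ≤ k then D k + |c| else 0)
  have hG : ∀ k, 0 ≤ G k := fun k => add_nonneg (Set.indicator_nonneg (fun k _ => hE k) k)
    (by split_ifs; exacts [hE k, le_rfl])
  have main : ∀ r k, k + r = M → r * c - ∑ i ∈ Finset.Ico k M, G i ≤ a k M := by
    intro r
    induction r using Nat.strong_induction_on with
    | _ r ih =>
      intro k hk
      rcases Nat.eq_zero_or_pos r with rfl | hr
      · obtain rfl : k = M := by omega
        simpa using ha0 k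
      by_cases hb : k ∉ bad ∧ k + N < M
      · obtain ⟨n, hn1, hnN, hn⟩ := hgood k hb.1
        have h1 := ih (r - n) (by omega) (k + n) (by omega)
        have h2 := ha k (k + n) M (by omega) (by omega)
        have h3 : ∑ i ∈ Finset.Ico (k + n) M, G i ≤ ∑ i ∈ Finset.Ico k M, G i :=
          Finset.sum_le_sum_of_subset_of_nonneg
            (Finset.Ico_subset_Ico (by omega) le_rfl) fun i _ _ => hG i
        rw [Nat.cast_sub (by omega)] at h1
        linarith
      · have h1 := ih (r - 1) (by omega) (k + 1) (by omega)
        have h2 := ha k (k + 1) M (by omega) (by omega)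
        have h3 : D k + |c| ≤ G k := by
          by_cases hkb : k ∈ bad
          · have : (0 : ℝ) ≤ if M - N ≤ k then D k + |c| else 0 := by
              split_ifs; exacts [hE k, le_rfl]
            simp only [G, Set.indicator_of_mem hkb]
            linarith
          · have hle : M - N ≤ k := by
              have : ¬ (k + N < M) := fun h => hb ⟨hkb, h⟩
              omega
            simp only [G, Set.indicator_of_notMem hkb, if_pos hle]
            linarith
        rw [Finset.sum_eq_sum_Ico_succ_bot (by omega : k < M)]
        rw [Nat.cast_sub (by omega)] at h1
        push_cast at h1
        linarith [hstep k, neg_abs_le c, le_abs_self c]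
  have := main M 0 (by omega)
  rw [← Finset.range_eq_Ico] at this
  simp only [G, Finset.sum_add_distrib] at this
  have h4 : ∑ k ∈ Finset.range M, (if M - N ≤ k then D k + |c| else 0) =
      ∑ k ∈ Finset.Ico (M - N) M, (D k + |c|) := by
    rw [← Finset.sum_filter]
    congr 1
    ext k
    simp only [Finset.mem_filter, Finset.mem_range, Finset.mem_Ico]
    tauto
  linarith

/-! ### The law of the weights -/

/-- The conditional law of the weights given the environment `G`: independent weights, with law
`G j` in row `j`. -/
noncomputable def quenchedLaw (G : Env) : Measure (ℕ × ℕ → ℝ) :=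
  Measure.infinitePi fun z : ℕ × ℕ => (G z.2 : Measure ℝ)

instance (G : Env) : IsProbabilityMeasure (quenchedLaw G) := by
  unfold quenchedLaw
  infer_instance

theorem quenchedLaw_pi (G : Env) (s : Finset (ℕ × ℕ)) {B : ℕ × ℕ → Set ℝ}
    (hB : ∀ z, MeasurableSet (B z)) :
    quenchedLaw G (Set.pi s B) = ∏ z ∈ s, (G z.2 : Measure ℝ) (B z) :=
  Measure.infinitePi_pi _ fun z _ => hB z

theorem measurable_env_apply (j : ℕ) {B : Set ℝ} (hB : MeasurableSet B) :
    Measurable fun G : Env => (G j : Measure ℝ) B :=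
  (Measure.measurable_coe hB).comp (measurable_subtype_coe.comp (measurable_pi_apply j))

theorem measurable_quenchedLaw : Measurable quenchedLaw := by
  refine Measurable.measure_of_isPiSystem_of_isProbabilityMeasure
    (generateFrom_squareCylinders (α := fun _ : ℕ × ℕ => ℝ)).symm
    (isPiSystem_squareCylinders (fun _ => MeasurableSpace.isPiSystem_measurableSet)
      fun _ => (MeasurableSet.univ : MeasurableSet (Set.univ : Set ℝ))) ?_
  rintro _ ⟨s, t, ht, rfl⟩
  have ht' : ∀ z, MeasurableSet (t z) := fun z => ht z (Set.mem_univ z)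
  simp only [quenchedLaw_pi _ s ht']
  exact Finset.measurable_prod _ fun z _ => measurable_env_apply z.2 (ht' z)

/-- The annealed law of the weights. -/
noncomputable def weightLaw (P : Measure Env) : Measure (ℕ × ℕ → ℝ) := P.bind quenchedLaw

theorem weightLaw_apply (P : Measure Env) {A : Set (ℕ × ℕ → ℝ)} (hA : MeasurableSet A) :
    weightLaw P A = ∫⁻ G, quenchedLaw G A ∂P :=
  Measure.bind_apply hA measurable_quenchedLaw.aemeasurable

instance (P : Measure Env) [IsProbabilityMeasure P] : IsProbabilityMeasure (weightLaw P) :=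
  ⟨by simp [weightLaw_apply]⟩

theorem IsModel.map_weight_eq {P : Measure Env} [IsProbabilityMeasure P] {Ω : Type*}
    [MeasurableSpace Ω] {μ : Measure Ω} [IsProbabilityMeasure μ] {F : Ω → Env}
    {X : ℕ × ℕ → Ω → ℝ} (hX : IsModel P μ F X) :
    μ.map (fun ω z => X z ω) = weightLaw P := by
  have hXm : Measurable fun ω z => X z ω := measurable_pi_lambda _ hX.measurable_weight
  have := Measure.isProbabilityMeasure_map (μ := μ) hXm.aemeasurable
  refine ext_of_generate_finite _ (generateFrom_squareCylinders (α := fun _ : ℕ × ℕ => ℝ)).symm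
    (isPiSystem_squareCylinders (fun _ => MeasurableSpace.isPiSystem_measurableSet)
      fun _ => (MeasurableSet.univ : MeasurableSet (Set.univ : Set ℝ))) ?_ (by simp)
  rintro _ ⟨s, t, ht, rfl⟩
  have ht' : ∀ z, MeasurableSet (t z) := fun z => ht z (Set.mem_univ z)
  have hs : MeasurableSet (Set.pi (s : Set (ℕ × ℕ)) t) :=
    MeasurableSet.pi s.countable_toSet fun z _ => ht' z
  rw [Measure.map_apply hXm hs, weightLaw_apply P hs]
  have h := hX.weight_law Set.univ MeasurableSet.univ s t ht'
  simp only [Set.mem_univ, true_and, Set.preimage_univ, Measure.restrict_univ] at h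
  have hset : (fun ω z => X z ω) ⁻¹' Set.pi (s : Set (ℕ × ℕ)) t = {ω | ∀ z ∈ s, X z ω ∈ t z} := by
    ext ω
    simp [Set.mem_pi]
  rw [hset, h]
  simp only [quenchedLaw_pi _ s ht']
  rw [← hX.map_env, lintegral_map _ hX.measurable_env]
  exact Finset.measurable_prod _ fun z _ => measurable_env_apply z.2 (ht' z)

theorem quenchedLaw_map_translate (G : Env) (a b : ℕ) :
    (quenchedLaw G).map (translate a b) = quenchedLaw fun j => G (b + j) := by
  have hf : Function.Injective fun z : ℕ × ℕ => (a + z.1, b + z.2) := by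
    rintro ⟨_, _⟩ ⟨_, _⟩ h
    simpa using h
  exact Measure.map_infinitePi_infinitePi_of_inj
    (P := fun z : ℕ × ℕ => (G z.2 : Measure ℝ)) hf

theorem quenchedLaw_translate_right (G : Env) :
    MeasurePreserving (translate 1 0) (quenchedLaw G) (quenchedLaw G) :=
  ⟨measurable_translate 1 0, by simp [quenchedLaw_map_translate]⟩

theorem quenchedLaw_shift (G : Env) :
    quenchedLaw (shift G) = (quenchedLaw G).map (translate 0 1) := by
  rw [quenchedLaw_map_translate]
  congr 1
  funext j
  simp [shift, add_comm]

/-- The law of the weights is invariant under both unit translations, and an event which is almost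
surely invariant under both of them is trivial. -/
structure IsErgodicField (ν : Measure (ℕ × ℕ → ℝ)) : Prop where
  right : MeasurePreserving (translate 1 0) ν ν
  up : MeasurePreserving (translate 0 1) ν ν
  zero_or_one : ∀ A : Set (ℕ × ℕ → ℝ), MeasurableSet A → translate 1 0 ⁻¹' A =ᵐ[ν] A →
    translate 0 1 ⁻¹' A =ᵐ[ν] A → ν A = 0 ∨ ν A = 1

/-- Kolmogorov's zero-one law: given the environment, the columns are independent and
identically distributed, so an event invariant under the horizontal translation is trivial. -/
theorem quenchedLaw_zero_or_one (G : Env) {A : Set (ℕ × ℕ → ℝ)} (hA : MeasurableSet A)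
    (hinv : translate 1 0 ⁻¹' A = A) : quenchedLaw G A = 0 ∨ quenchedLaw G A = 1 := by
  have hind : iIndepFun (fun (z : ℕ × ℕ) (w : ℕ × ℕ → ℝ) => w z) (quenchedLaw G) :=
    iIndepFun_infinitePi (P := fun z : ℕ × ℕ => (G z.2 : Measure ℝ)) (X := fun _ x => x)
      fun _ => measurable_id
  let s : ℕ × ℕ → MeasurableSpace (ℕ × ℕ → ℝ) := fun z =>
    MeasurableSpace.comap (fun w => w z) inferInstance
  refine measure_zero_or_one_of_measurableSet_limsup (s := s)
    (f := comap Prod.fst atTop) (p := fun t => ∃ n, t ⊆ {z | z.1 ≤ n})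
    (ns := fun n : ℕ => {z : ℕ × ℕ | z.1 ≤ n})
    (fun z => (measurable_pi_apply z).comap_le) hind ?_ ?_ (fun n => ⟨n, subset_rfl⟩)
    (fun z => ⟨z.1, le_refl z.1⟩) ?_
  · rintro t ⟨n, hn⟩
    refine mem_comap.2 ⟨Set.Ioi n, Ioi_mem_atTop n, ?_⟩
    intro z hz hzt
    have h1 : n < z.1 := hz
    have h2 : z.1 ≤ n := hn hzt
    omega
  · intro m n
    refine ⟨max m n, fun z hz => ?_, fun z hz => ?_⟩ <;>
      simp only [Set.mem_ofPred_eq] at * <;> omega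
  · have hiter : ∀ n, translate n 0 ⁻¹' A = A := by
      intro n
      induction n with
      | zero => ext w; simp
      | succ n ih =>
        have : translate (n + 1) 0 = translate 1 0 ∘ translate n 0 := by
          funext w
          simp [translate_translate]
        rw [this, Set.preimage_comp, hinv, ih]
    rw [limsup_eq_iInf_iSup]
    rw [MeasurableSpace.measurableSet_iInf]
    intro t
    rw [MeasurableSpace.measurableSet_iInf]
    intro ht
    obtain ⟨u, hu, hut⟩ := mem_comap.1 ht
    obtain ⟨n, hn⟩ := mem_atTop_sets.1 hu
    rw [← hiter n]
    have hm : @Measurable _ _ (⨆ a ∈ t, s a) _ (translate n 0) := by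
      refine @measurable_pi_lambda _ _ _ (_) _ _ fun z => ?_
      have hz : (n + z.1, 0 + z.2) ∈ t := hut (hn _ (Nat.le_add_right n z.1))
      exact (comap_measurable _).mono (le_iSup₂_of_le (n + z.1, 0 + z.2) hz le_rfl) le_rfl
    exact hm hA

theorem isErgodicField_weightLaw {P : Measure Env} [IsProbabilityMeasure P]
    (hP : Ergodic shift P) : IsErgodicField (weightLaw P) := by
  have hright : MeasurePreserving (translate 1 0) (weightLaw P) (weightLaw P) := by
    refine ⟨measurable_translate 1 0, ?_⟩
    ext A hA
    rw [Measure.map_apply (measurable_translate 1 0) hA,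
      weightLaw_apply P (measurable_translate 1 0 hA), weightLaw_apply P hA]
    exact lintegral_congr fun G => (quenchedLaw_translate_right G).measure_preimage
      hA.nullMeasurableSet
  have hquenched_up : ∀ (G : Env) {A : Set (ℕ × ℕ → ℝ)}, MeasurableSet A →
      quenchedLaw G (translate 0 1 ⁻¹' A) = quenchedLaw (shift G) A := by
    intro G A hA
    rw [quenchedLaw_shift, Measure.map_apply (measurable_translate 0 1) hA]
  have hmeas : ∀ {A : Set (ℕ × ℕ → ℝ)}, MeasurableSet A →
      Measurable fun G => quenchedLaw G A := fun hA =>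
    (Measure.measurable_coe hA).comp measurable_quenchedLaw
  have hup : MeasurePreserving (translate 0 1) (weightLaw P) (weightLaw P) := by
    refine ⟨measurable_translate 0 1, ?_⟩
    ext A hA
    rw [Measure.map_apply (measurable_translate 0 1) hA,
      weightLaw_apply P (measurable_translate 0 1 hA), weightLaw_apply P hA]
    simp only [hquenched_up _ hA]
    exact hP.toMeasurePreserving.lintegral_comp (hmeas hA)
  refine ⟨hright, hup, ?_⟩
  intro A hA h1 h2
  -- Pass to a version of `A` which is strictly invariant under the horizontal translation.
  obtain ⟨B, hB, hBA, hBinv⟩ := hright.quasiMeasurePreserving.exists_preimage_eq_of_preimage_ae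
    hA.nullMeasurableSet h1
  rw [← measure_congr hBA]
  have h01 := fun G => quenchedLaw_zero_or_one G hB hBinv
  have hB2 : translate 0 1 ⁻¹' B =ᵐ[weightLaw P] B :=
    (hup.quasiMeasurePreserving.preimage_ae_eq hBA).trans (h2.trans hBA.symm)
  have hae : ∀ᵐ G ∂P, ∀ᵐ w ∂quenchedLaw G, w ∈ translate 0 1 ⁻¹' B ↔ w ∈ B :=
    Measure.ae_ae_of_ae_bind measurable_quenchedLaw.aemeasurable (eventuallyEq_set.1 hB2)
  have hcomp : (fun G => quenchedLaw G B) ∘ shift =ᵐ[P] fun G => quenchedLaw G B := by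
    filter_upwards [hae] with G hG
    rw [Function.comp_apply, ← hquenched_up G hB]
    exact measure_congr (eventuallyEq_set.2 hG)
  obtain ⟨c, hc⟩ := hP.quasiErgodic.ae_eq_const_of_ae_eq_comp₀ (hmeas hB).nullMeasurable hcomp
  have hνB : weightLaw P B = c := by
    rw [weightLaw_apply P hB, lintegral_congr_ae hc]
    simp
  obtain ⟨G, hG⟩ := hc.exists
  rw [hνB]
  have hG' : quenchedLaw G B = c := hG
  rw [← hG']
  exact h01 G

/-! ### Chains of open points -/

/-- Auxiliary to `chains`: the chains in rows `< j` and columns `≤ i` that use column `i`, listed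
by their topmost point in column `i`; `Z` lists the chains in columns `< i`. -/
def chainsUsing (i : ℕ) (Z : ℕ → List (Finset (ℕ × ℕ))) : ℕ → List (Finset (ℕ × ℕ))
  | 0 => []
  | j + 1 => chainsUsing i Z j ++ (chainsUsing i Z j ++ Z (j + 1)).map (insert (i, j))

/-- The chains (finite totally ordered sets for the product order) in `[0, i) × [0, j)`. -/
def chains : ℕ → ℕ → List (Finset (ℕ × ℕ))
  | 0 => fun _ => [∅]
  | i + 1 => fun j => chains i j ++ chainsUsing i (chains i) j

/-- The generating function of a list of finite sets of points. -/
def genSum (l : List (Finset (ℕ × ℕ))) (w : ℕ × ℕ → ℝ) : ℝ :=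
  (l.map fun S => ∏ z ∈ S, w z).sum

theorem genSum_append (l l' : List (Finset (ℕ × ℕ))) (w : ℕ × ℕ → ℝ) :
    genSum (l ++ l') w = genSum l w + genSum l' w := by
  simp [genSum]

theorem genSum_map_insert {l : List (Finset (ℕ × ℕ))} {z : ℕ × ℕ} (h : ∀ S ∈ l, z ∉ S)
    (w : ℕ × ℕ → ℝ) : genSum (l.map (insert z)) w = w z * genSum l w := by
  induction l with
  | nil => simp [genSum]
  | cons S l ih =>
    have h1 := ih fun S hS => h S (List.mem_cons_of_mem _ hS)
    simp only [genSum, List.map_cons, List.sum_cons] at *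
    rw [Finset.prod_insert (h S List.mem_cons_self), h1]
    ring

theorem genSum_nonneg (l : List (Finset (ℕ × ℕ))) {w : ℕ × ℕ → ℝ} (hw : ∀ z, 0 ≤ w z) :
    0 ≤ genSum l w := by
  refine List.sum_nonneg ?_
  simp only [List.mem_map, forall_exists_index, and_imp]
  rintro _ S - rfl
  exact Finset.prod_nonneg fun z _ => hw z

theorem lt_of_mem_chainsUsing {i : ℕ} {Z : ℕ → List (Finset (ℕ × ℕ))}
    (hZ : ∀ j, ∀ S ∈ Z j, ∀ z ∈ S, z.1 < i ∧ z.2 < j) (j : ℕ) :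
    ∀ S ∈ chainsUsing i Z j, ∀ z ∈ S, z.1 < i + 1 ∧ z.2 < j := by
  induction j with
  | zero => simp [chainsUsing]
  | succ j ih =>
    intro S hS z hz
    simp only [chainsUsing, List.mem_append, List.mem_map] at hS
    rcases hS with hS | ⟨S', hS', rfl⟩
    · have := ih S hS z hz
      omega
    · rcases Finset.mem_insert.1 hz with rfl | hz
      · simp
      · rcases hS' with hS' | hS'
        · have := ih S' hS' z hz
          omega
        · have := hZ _ S' hS' z hz
          omega

theorem lt_of_mem_chains (i : ℕ) : ∀ j, ∀ S ∈ chains i j, ∀ z ∈ S, z.1 < i ∧ z.2 < j := by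
  induction i with
  | zero => simp [chains]
  | succ i ih =>
    intro j S hS z hz
    rcases List.mem_append.1 hS with hS | hS
    · have := ih j S hS z hz
      omega
    · exact lt_of_mem_chainsUsing ih j S hS z hz

theorem genSum_chains_zero (j : ℕ) (w : ℕ × ℕ → ℝ) : genSum (chains 0 j) w = 1 := by
  simp [genSum, chains]

theorem genSum_chainsUsing_succ (i j : ℕ) (w : ℕ × ℕ → ℝ) :
    genSum (chainsUsing i (chains i) (j + 1)) w = genSum (chainsUsing i (chains i) j) w +
      w (i, j) * (genSum (chainsUsing i (chains i) j) w + genSum (chains i (j + 1)) w) := by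
  rw [chainsUsing, genSum_append, genSum_map_insert, genSum_append]
  intro S hS hz
  rcases List.mem_append.1 hS with hS | hS
  · have := lt_of_mem_chainsUsing (lt_of_mem_chains i) j S hS _ hz
    simp at this
  · have := lt_of_mem_chains i _ S hS _ hz
    simp at this

theorem genSum_chains_succ (i j : ℕ) (w : ℕ × ℕ → ℝ) :
    genSum (chains (i + 1) j) w =
      genSum (chains i j) w + genSum (chainsUsing i (chains i) j) w :=
  genSum_append _ _ w

theorem genSum_chainsUsing_mono (i j : ℕ) {w : ℕ × ℕ → ℝ} (hw : ∀ z, 0 ≤ w z) :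
    genSum (chainsUsing i (chains i) j) w ≤ genSum (chainsUsing i (chains i) (j + 1)) w := by
  rw [genSum_chainsUsing_succ]
  have := mul_nonneg (hw (i, j)) (add_nonneg (genSum_nonneg (chainsUsing i (chains i) j) hw)
    (genSum_nonneg (chains i (j + 1)) hw))
  linarith

theorem genSum_chains_mono (i j : ℕ) {w : ℕ × ℕ → ℝ} (hw : ∀ z, 0 ≤ w z) :
    genSum (chains i j) w ≤ genSum (chains i (j + 1)) w := by
  induction i with
  | zero => simp [genSum_chains_zero]
  | succ i ih =>
    rw [genSum_chains_succ, genSum_chains_succ]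
    exact add_le_add ih (genSum_chainsUsing_mono i j hw)

theorem genSum_chains_corner (i j : ℕ) (w : ℕ × ℕ → ℝ) :
    genSum (chains (i + 1) (j + 1)) w =
      (1 + w (i, j)) * (genSum (chains i (j + 1)) w + genSum (chainsUsing i (chains i) j) w) := by
  rw [genSum_chains_succ, genSum_chainsUsing_succ]
  ring

/-- For `0`-`1` weights, each subset of the open points on an optimal path is a chain of open
points, so `2 ^ lpp` is at most the number of chains of open points. The factor `1 + w (i, j)` accounts for
the endpoint, whose weight `lpp` does not include. -/
theorem two_rpow_lpp_mul_le (w : ℕ × ℕ → ℝ) (hw : ∀ z, w z = 0 ∨ w z = 1) (i j : ℕ) :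
    (2 : ℝ) ^ lpp w i j * (1 + w (i, j)) ≤ genSum (chains (i + 1) (j + 1)) w := by
  have hw0 : ∀ z, 0 ≤ w z := fun z => by rcases hw z with h | h <;> simp [h]
  have hpow : ∀ z, (2 : ℝ) ^ w z = 1 + w z := fun z => by
    rcases hw z with h | h <;> norm_num [h]
  refine lpp_induction (w := w) (Q := fun i j t =>
    (2 : ℝ) ^ t * (1 + w (i, j)) ≤ genSum (chains (i + 1) (j + 1)) w) ?_ ?_ ?_ i j
  · rw [genSum_chains_corner, genSum_chains_zero]
    simp [chainsUsing, genSum]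
  · intro i j h
    rw [Real.rpow_add two_pos, hpow, genSum_chains_corner, mul_comm]
    refine mul_le_mul_of_nonneg_left ?_ (by linarith [hw0 (i + 1, j)])
    have := genSum_nonneg (chainsUsing (i + 1) (chains (i + 1)) j) hw0
    linarith
  · intro i j h
    rw [Real.rpow_add two_pos, hpow, genSum_chains_corner, mul_comm]
    refine mul_le_mul_of_nonneg_left ?_ (by linarith [hw0 (i, j + 1)])
    have := genSum_chains_mono i (j + 1) hw0
    rw [genSum_chains_succ] at h
    linarith

/-- The generating function of the chains in a box, for weights that depend on the row only. -/
theorem genSum_chains_le {p : ℕ → ℝ} {t : ℝ} (hp0 : ∀ j, 0 ≤ p j) (hpt : ∀ j, p j < t)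
    (ht1 : t < 1) (i j : ℕ) :
    genSum (chains i j) (fun z => p z.2) ≤
      (∏ k ∈ Finset.range j, (1 - p k / t)⁻¹) * (1 - t)⁻¹ ^ i := by
  have ht0 : 0 < t := (hp0 0).trans_lt (hpt 0)
  have hR : 0 < (1 - t)⁻¹ := inv_pos.2 (by linarith)
  have hR1 : (1 - t) * (1 - t)⁻¹ = 1 := mul_inv_cancel₀ (by linarith)
  have hpos : ∀ k, 0 < 1 - p k / t := fun k => by
    have := (div_lt_one ht0).2 (hpt k)
    linarith
  have hc : ∀ j, 0 < ∏ k ∈ Finset.range j, (1 - p k / t)⁻¹ := fun j =>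
    Finset.prod_pos fun k _ => inv_pos.2 (hpos k)
  have hZ0 : ∀ j, 1 ≤ ∏ k ∈ Finset.range j, (1 - p k / t)⁻¹ := by
    intro j
    induction j with
    | zero => simp
    | succ j ih =>
      rw [Finset.prod_range_succ]
      refine one_le_mul_of_one_le_of_one_le ih ((one_le_inv₀ (hpos j)).2 ?_)
      have := div_nonneg (hp0 j) ht0.le
      linarith
  have hD : ∀ i, (∀ j, genSum (chains i j) (fun z => p z.2) ≤
      (∏ k ∈ Finset.range j, (1 - p k / t)⁻¹) * (1 - t)⁻¹ ^ i) → ∀ j,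
      genSum (chainsUsing i (chains i) j) (fun z => p z.2) ≤
        (∏ k ∈ Finset.range j, (1 - p k / t)⁻¹) * (t * (1 - t)⁻¹ ^ (i + 1)) := by
    intro i hi j
    induction j with
    | zero =>
      have : (0 : ℝ) ≤ t * (1 - t)⁻¹ ^ (i + 1) := by positivity
      simpa [chainsUsing, genSum] using this
    | succ j ih =>
      have h1 := hi (j + 1)
      have hcj : ∏ k ∈ Finset.range j, (1 - p k / t)⁻¹ =
          (∏ k ∈ Finset.range (j + 1), (1 - p k / t)⁻¹) * (1 - p j / t) := by
        rw [Finset.prod_range_succ, mul_assoc, inv_mul_cancel₀ (hpos j).ne', mul_one]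
      have hpow : (1 - t)⁻¹ ^ i = (1 - t) * (1 - t)⁻¹ ^ (i + 1) := by
        rw [pow_succ, mul_comm ((1 - t)⁻¹ ^ i), ← mul_assoc, hR1, one_mul]
      rw [genSum_chainsUsing_succ]
      rw [hcj] at ih
      rw [hpow] at h1
      set c := ∏ k ∈ Finset.range (j + 1), (1 - p k / t)⁻¹ with hcdef
      set R := (1 - t)⁻¹ ^ (i + 1) with hRdef
      have hcR : 0 ≤ c * R := mul_nonneg (hc _).le (by positivity)
      have hpj := hp0 j
      have hpj2 : c * (1 - p j / t) * (t * R) = c * R * (t - p j) := by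
        field_simp
      rw [hpj2] at ih
      have h2 := mul_le_mul_of_nonneg_left ih (by linarith : (0 : ℝ) ≤ 1 + p j)
      have h3 := mul_le_mul_of_nonneg_left h1 hpj
      have h4 : 0 ≤ c * R * p j ^ 2 := by positivity
      dsimp only
      linarith
  induction i generalizing j with
  | zero => simpa [genSum_chains_zero] using hZ0 j
  | succ i ih =>
    rw [genSum_chains_succ]
    have h1 := ih j
    have h2 := hD i ih j
    have hpow : (1 - t)⁻¹ ^ (i + 1) = (1 - t)⁻¹ ^ i + t * (1 - t)⁻¹ ^ (i + 1) := by
      have : (1 - t)⁻¹ ^ i = (1 - t) * (1 - t)⁻¹ ^ (i + 1) := by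
        rw [pow_succ, mul_comm ((1 - t)⁻¹ ^ i), ← mul_assoc, hR1, one_mul]
      rw [this]
      ring
    rw [hpow, mul_add]
    exact add_le_add h1 h2

theorem inv_one_sub_le_exp {x : ℝ} (h0 : 0 ≤ x) (h1 : x ≤ 1 / 2) :
    (1 - x)⁻¹ ≤ Real.exp (2 * x) := by
  have h2 : (1 - x)⁻¹ ≤ 2 * x + 1 := by
    rw [inv_le_iff_one_le_mul₀ (by linarith)]
    nlinarith
  exact h2.trans (Real.add_one_le_exp _)

theorem genSum_chains_le_exp {p : ℕ → ℝ} {t : ℝ} (ht0 : 0 < t) (ht1 : t ≤ 1 / 2)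
    (hp0 : ∀ j, 0 ≤ p j) (hpt : ∀ j, p j ≤ t / 2) (i j : ℕ) :
    genSum (chains i j) (fun z => p z.2) ≤
      Real.exp (2 * t * i + 2 / t * ∑ k ∈ Finset.range j, p k) := by
  refine (genSum_chains_le hp0 (fun k => (hpt k).trans_lt (half_lt_self ht0)) (by linarith)
    i j).trans ?_
  have h1 : ∏ k ∈ Finset.range j, (1 - p k / t)⁻¹ ≤
      Real.exp (2 / t * ∑ k ∈ Finset.range j, p k) := by
    rw [Finset.mul_sum, Real.exp_sum]
    refine Finset.prod_le_prod (fun k _ => ?_) fun k _ => ?_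
    · have : p k / t ≤ 1 := (div_le_one ht0).2 (by linarith [hpt k])
      exact inv_nonneg.2 (by linarith)
    · have := inv_one_sub_le_exp (div_nonneg (hp0 k) ht0.le)
        ((div_le_iff₀ ht0).2 (by linarith [hpt k]))
      convert! this using 2
      ring
  have h2 : (1 - t)⁻¹ ^ i ≤ Real.exp (2 * t * i) := by
    rw [mul_comm _ (i : ℝ), Real.exp_nat_mul]
    exact pow_le_pow_left₀ (inv_nonneg.2 (by linarith)) (inv_one_sub_le_exp ht0.le ht1) i
  rw [add_comm, Real.exp_add]
  exact mul_le_mul h1 h2 (pow_nonneg (inv_nonneg.2 (by linarith)) i) (Real.exp_pos _).le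

/-! ### The expected last-passage time of large weights -/

/-- The indicator of the points whose weight exceeds the level `v`. -/
noncomputable def exceed (v : ℝ) (w : ℕ × ℕ → ℝ) : ℕ × ℕ → ℝ := fun z => if v < w z then 1 else 0

theorem exceed_eq_zero_or_one (v : ℝ) (w : ℕ × ℕ → ℝ) (z : ℕ × ℕ) :
    exceed v w z = 0 ∨ exceed v w z = 1 := by
  unfold exceed
  split_ifs <;> simp

theorem exceed_nonneg (v : ℝ) (w : ℕ × ℕ → ℝ) (z : ℕ × ℕ) : 0 ≤ exceed v w z := by
  rcases exceed_eq_zero_or_one v w z with h | h <;> simp [h]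

theorem exceed_le_one (v : ℝ) (w : ℕ × ℕ → ℝ) (z : ℕ × ℕ) : exceed v w z ≤ 1 := by
  rcases exceed_eq_zero_or_one v w z with h | h <;> simp [h]

theorem measurable_exceed : Measurable fun q : (ℕ × ℕ → ℝ) × ℝ => exceed q.2 q.1 := by
  refine measurable_pi_lambda _ fun z => ?_
  exact Measurable.ite
    (measurableSet_lt measurable_snd ((measurable_pi_apply z).comp measurable_fst))
    measurable_const measurable_const

theorem measurable_exceed_right (v : ℝ) : Measurable (exceed v) :=
  measurable_exceed.comp (measurable_id.prodMk measurable_const)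

/-- The conditional probability that a weight in row `j` exceeds `v`. -/
noncomputable def rowTail (v : ℝ) (G : Env) (j : ℕ) : ℝ := (G j : Measure ℝ).real (Set.Ioi v)

theorem rowTail_nonneg (v : ℝ) (G : Env) (j : ℕ) : 0 ≤ rowTail v G j := measureReal_nonneg

theorem rowTail_le_one (v : ℝ) (G : Env) (j : ℕ) : rowTail v G j ≤ 1 := measureReal_le_one

theorem rowTail_eq (v : ℝ) (G : Env) (j : ℕ) : rowTail v G j = 1 - cdf (G j : Measure ℝ) v := by
  rw [rowTail, cdf_eq_real, ← Set.compl_Iic, probReal_compl_eq_one_sub measurableSet_Iic]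

theorem measurable_rowTail (v : ℝ) (j : ℕ) : Measurable fun G => rowTail v G j :=
  (measurable_env_apply j measurableSet_Ioi).ennreal_toReal

theorem prod_exceed_eq_indicator (v : ℝ) (S : Finset (ℕ × ℕ)) :
    (fun w => ∏ z ∈ S, exceed v w z) =
      (Set.pi (S : Set (ℕ × ℕ)) fun _ => Set.Ioi v).indicator 1 := by
  funext w
  by_cases h : w ∈ Set.pi (S : Set (ℕ × ℕ)) fun _ => Set.Ioi v
  · rw [Set.indicator_of_mem h]
    exact Finset.prod_eq_one fun z hz => if_pos (h z hz)
  · rw [Set.indicator_of_notMem h]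
    simp only [Set.mem_pi, not_forall] at h
    obtain ⟨z, hz, hzv⟩ := h
    exact Finset.prod_eq_zero hz (if_neg hzv)

theorem integrable_prod_exceed (G : Env) (v : ℝ) (S : Finset (ℕ × ℕ)) :
    Integrable (fun w => ∏ z ∈ S, exceed v w z) (quenchedLaw G) := by
  rw [prod_exceed_eq_indicator]
  exact (integrable_const (1 : ℝ)).indicator
    (MeasurableSet.pi S.countable_toSet fun _ _ => measurableSet_Ioi)

theorem integral_prod_exceed (G : Env) (v : ℝ) (S : Finset (ℕ × ℕ)) :
    ∫ w, ∏ z ∈ S, exceed v w z ∂quenchedLaw G = ∏ z ∈ S, rowTail v G z.2 := by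
  rw [prod_exceed_eq_indicator, integral_indicator_one
    (MeasurableSet.pi S.countable_toSet fun _ _ => measurableSet_Ioi), measureReal_def,
    quenchedLaw_pi G S (B := fun _ => Set.Ioi v) fun _ => measurableSet_Ioi, ENNReal.toReal_prod]
  rfl

theorem integral_genSum_exceed (G : Env) (v : ℝ) (l : List (Finset (ℕ × ℕ))) :
    Integrable (fun w => genSum l (exceed v w)) (quenchedLaw G) ∧
      ∫ w, genSum l (exceed v w) ∂quenchedLaw G = genSum l fun z => rowTail v G z.2 := by
  induction l with
  | nil => simp [genSum]
  | cons S l ih =>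
    simp only [genSum, List.map_cons, List.sum_cons] at *
    refine ⟨(integrable_prod_exceed G v S).add ih.1, ?_⟩
    rw [integral_add (integrable_prod_exceed G v S) ih.1, ih.2, integral_prod_exceed]

theorem integrable_lpp_exceed (ν : Measure (ℕ × ℕ → ℝ)) [IsFiniteMeasure ν] (v : ℝ) (i j : ℕ) :
    Integrable (fun w => lpp (exceed v w) i j) ν := by
  refine Integrable.of_bound ((measurable_lpp i j).comp
    (measurable_exceed_right v)).aestronglyMeasurable (1 * (i + j))
    (Eventually.of_forall fun w => ?_)
  rw [Real.norm_of_nonneg (lpp_nonneg (exceed_nonneg v w) i j)]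
  exact lpp_le_of_le (exceed_le_one v w) i j

/-- The first-moment bound for `2 ^ lpp`, turned into a bound for the mean of `lpp` by means of
the tangent of the logarithm at `exp s`. -/
theorem integral_lpp_exceed_quenched_le (G : Env) (v : ℝ) {t : ℝ} (ht0 : 0 < t) (ht1 : t ≤ 1 / 2)
    (hG : ∀ j, rowTail v G j ≤ t / 2) (i j : ℕ) :
    ∫ w, lpp (exceed v w) i j ∂quenchedLaw G ≤
      2 * (2 * t * (i + 1) + 2 / t * ∑ k ∈ Finset.range (j + 1), rowTail v G k) := by
  set s : ℝ := 2 * t * (i + 1) + 2 / t * ∑ k ∈ Finset.range (j + 1), rowTail v G k with hs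
  obtain ⟨hint, hval⟩ := integral_genSum_exceed G v (chains (i + 1) (j + 1))
  have hs0 : 0 ≤ s := by
    have := Finset.sum_nonneg fun k (_ : k ∈ Finset.range (j + 1)) => rowTail_nonneg v G k
    positivity
  have hZ : genSum (chains (i + 1) (j + 1)) (fun z => rowTail v G z.2) ≤ Real.exp s := by
    have := genSum_chains_le_exp ht0 ht1 (rowTail_nonneg v G) hG (i + 1) (j + 1)
    push_cast at this
    exact this
  have hpt : ∀ w, Real.log 2 * lpp (exceed v w) i j ≤
      s + (genSum (chains (i + 1) (j + 1)) (exceed v w) * Real.exp (-s) - 1) := by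
    intro w
    have h1 := two_rpow_lpp_mul_le (exceed v w) (exceed_eq_zero_or_one v w) i j
    have h2 : (2 : ℝ) ^ lpp (exceed v w) i j ≤ genSum (chains (i + 1) (j + 1)) (exceed v w) := by
      have : 0 ≤ (2 : ℝ) ^ lpp (exceed v w) i j := by positivity
      nlinarith [exceed_nonneg v w (i, j)]
    rw [Real.rpow_def_of_pos two_pos] at h2
    have h3 := Real.add_one_le_exp (Real.log 2 * lpp (exceed v w) i j - s)
    rw [sub_eq_add_neg, Real.exp_add] at h3
    have h4 := mul_le_mul_of_nonneg_right h2 (Real.exp_pos (-s)).le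
    linarith
  have h5 : Real.log 2 * ∫ w, lpp (exceed v w) i j ∂quenchedLaw G ≤ s := by
    rw [← integral_const_mul]
    refine (integral_mono ((integrable_lpp_exceed _ v i j).const_mul _)
      ((integrable_const s).add ((hint.mul_const _).sub (integrable_const 1))) hpt).trans ?_
    have e1 : ∫ w, (s + (genSum (chains (i + 1) (j + 1)) (exceed v w) * Real.exp (-s) - 1))
        ∂quenchedLaw G = s + ((genSum (chains (i + 1) (j + 1)) fun z => rowTail v G z.2) *
          Real.exp (-s) - 1) := by
      have hint' := hint.mul_const (Real.exp (-s))
      have hsub : Integrable (fun w =>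
          genSum (chains (i + 1) (j + 1)) (exceed v w) * Real.exp (-s) - 1) (quenchedLaw G) :=
        hint'.sub (integrable_const 1)
      rw [integral_add (integrable_const s) hsub, integral_sub hint' (integrable_const 1),
        integral_mul_const, hval]
      simp
    have e2 : (genSum (chains (i + 1) (j + 1)) fun z => rowTail v G z.2) * Real.exp (-s) ≤ 1 := by
      refine (mul_le_mul_of_nonneg_right hZ (Real.exp_pos (-s)).le).trans ?_
      rw [← Real.exp_add]
      simp
    change ∫ w, (s + (genSum (chains (i + 1) (j + 1)) (exceed v w) * Real.exp (-s) - 1))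
        ∂quenchedLaw G ≤ s
    rw [e1]
    linarith
  have hL : 0 ≤ ∫ w, lpp (exceed v w) i j ∂quenchedLaw G :=
    integral_nonneg fun w => lpp_nonneg (exceed_nonneg v w) i j
  have hlog : (1 : ℝ) / 2 ≤ Real.log 2 := by linarith [Real.log_two_gt_d9]
  nlinarith

theorem ae_rowTail_le {P : Measure Env} (hP : MeasurePreserving shift P P) {v b : ℝ}
    (hb : ∀ᵐ G ∂P, rowTail v G 0 ≤ b) : ∀ᵐ G ∂P, ∀ j, rowTail v G j ≤ b := by
  rw [ae_all_iff]
  intro j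
  induction j with
  | zero => exact hb
  | succ j ih => exact hP.quasiMeasurePreserving.ae ih

theorem integrable_rowTail (P : Measure Env) [IsProbabilityMeasure P] (v : ℝ) (j : ℕ) :
    Integrable (fun G => rowTail v G j) P := by
  refine Integrable.of_bound (measurable_rowTail v j).aestronglyMeasurable 1
    (Eventually.of_forall fun G => ?_)
  rw [Real.norm_of_nonneg (rowTail_nonneg v G j)]
  exact rowTail_le_one v G j

theorem integral_rowTail_eq {P : Measure Env} (hP : MeasurePreserving shift P P) (v : ℝ) (j : ℕ) :
    ∫ G, rowTail v G j ∂P = ∫ G, rowTail v G 0 ∂P := by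
  induction j with
  | zero => rfl
  | succ j ih =>
    rw [← ih, ← hP.map_eq, integral_map hP.measurable.aemeasurable
      (measurable_rowTail v j).aestronglyMeasurable, hP.map_eq]
    rfl

/-- Averaging the conditional bound over the environment. When `t > 1 / 2` the bound is trivial,
because a path collects at most `i + j` points. -/
theorem lintegral_lpp_exceed_le {P : Measure Env} [IsProbabilityMeasure P]
    (hP : MeasurePreserving shift P P) {v t : ℝ} (ht0 : 0 < t)
    (hb : ∀ᵐ G ∂P, rowTail v G 0 ≤ t / 2) (hq : ∫ G, rowTail v G 0 ∂P ≤ t ^ 2) (i j : ℕ) :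
    ∫⁻ w, ENNReal.ofReal (lpp (exceed v w) i j) ∂weightLaw P ≤
      ENNReal.ofReal (8 * (i + j + 1) * t) := by
  rcases le_or_gt t (1 / 2) with ht1 | ht1
  · have hm : Measurable fun w => ENNReal.ofReal (lpp (exceed v w) i j) :=
      ((measurable_lpp i j).comp (measurable_exceed_right v)).ennreal_ofReal
    rw [weightLaw, Measure.lintegral_bind measurable_quenchedLaw.aemeasurable hm.aemeasurable]
    have h1 : ∀ᵐ G ∂P, ∫⁻ w, ENNReal.ofReal (lpp (exceed v w) i j) ∂quenchedLaw G ≤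
        ENNReal.ofReal (2 * (2 * t * (i + 1) +
          2 / t * ∑ k ∈ Finset.range (j + 1), rowTail v G k)) := by
      filter_upwards [ae_rowTail_le hP hb] with G hG
      rw [← ofReal_integral_eq_lintegral_ofReal (integrable_lpp_exceed _ v i j)
        (Eventually.of_forall fun w => lpp_nonneg (exceed_nonneg v w) i j)]
      exact ENNReal.ofReal_le_ofReal (integral_lpp_exceed_quenched_le G v ht0 ht1 hG i j)
    refine (lintegral_mono_ae h1).trans ?_
    have hsum : Integrable (fun G => ∑ k ∈ Finset.range (j + 1), rowTail v G k) P :=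
      integrable_finsetSum _ fun k _ => integrable_rowTail P v k
    have hint : Integrable (fun G => 2 * (2 * t * (i + 1) +
        2 / t * ∑ k ∈ Finset.range (j + 1), rowTail v G k)) P :=
      ((integrable_const _).add (hsum.const_mul _)).const_mul _
    rw [← ofReal_integral_eq_lintegral_ofReal hint (Eventually.of_forall fun G => by
      have := Finset.sum_nonneg fun k (_ : k ∈ Finset.range (j + 1)) => rowTail_nonneg v G k
      positivity)]
    refine ENNReal.ofReal_le_ofReal ?_
    rw [integral_const_mul, integral_add (integrable_const _) (hsum.const_mul _),
      integral_const_mul (2 / t), integral_finsetSum _ fun k _ => integrable_rowTail P v k]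
    simp only [integral_rowTail_eq hP, Finset.sum_const, Finset.card_range, nsmul_eq_mul,
      integral_const, probReal_univ, smul_eq_mul, one_mul]
    set q := ∫ G, rowTail v G 0 ∂P
    have h2 : 2 / t * (((j + 1 : ℕ) : ℝ) * q) ≤ 2 * t * (j + 1) := by
      rw [div_mul_eq_mul_div, div_le_iff₀ ht0]
      push_cast
      have : ((j : ℝ) + 1) * q ≤ (j + 1) * t ^ 2 := mul_le_mul_of_nonneg_left hq (by positivity)
      linarith
    have h3 : 0 ≤ t * i := by positivity
    have h4 : 0 ≤ t * j := by positivity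
    linarith
  · calc ∫⁻ w, ENNReal.ofReal (lpp (exceed v w) i j) ∂weightLaw P
        ≤ ∫⁻ _, ENNReal.ofReal (8 * (i + j + 1) * t) ∂weightLaw P := by
          refine lintegral_mono fun w => ENNReal.ofReal_le_ofReal ?_
          have h1 := lpp_le_of_le (exceed_le_one v w) i j
          have h2 : (0 : ℝ) ≤ i + j := by positivity
          nlinarith
      _ = ENNReal.ofReal (8 * (i + j + 1) * t) := by simp

/-- The weights have uniformly small excess: truncating the weights at a high level changes the
expected last-passage time to `(i, j)` by at most a small multiple of `i + j + 1`. -/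
def HasSmallExcess (ν : Measure (ℕ × ℕ → ℝ)) : Prop :=
  ∀ ε : ℝ, 0 < ε → ∃ K : ℝ, 0 ≤ K ∧ ∀ i j : ℕ,
    ∫ w, lpp (fun z => max (w z - K) 0) i j ∂ν ≤ ε * (i + j + 1)

theorem hasSmallExcess_weightLaw {P : Measure Env} [IsProbabilityMeasure P]
    (hP : MeasurePreserving shift P P)
    (htail1 : ∫⁻ u in Set.Ioi (0 : ℝ),
      ENNReal.ofReal (Real.sqrt (1 - ∫ G, cdf (G 0 : Measure ℝ) u ∂P)) < ⊤)
    (htail2 : ∫⁻ u in Set.Ioi (0 : ℝ),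
      ENNReal.ofReal (essSup (fun G : Env => 1 - cdf (G 0 : Measure ℝ) u) P) < ⊤) :
    HasSmallExcess (weightLaw P) := by
  have hq : ∀ u, 1 - ∫ G, cdf (G 0 : Measure ℝ) u ∂P = ∫ G, rowTail u G 0 ∂P := by
    intro u
    have : (fun G : Env => cdf (G 0 : Measure ℝ) u) = fun G => 1 - rowTail u G 0 := by
      funext G
      rw [rowTail_eq]
      ring
    rw [this, integral_sub (integrable_const _) (integrable_rowTail P u 0)]
    simp
  simp only [hq] at htail1
  have hb' : ∀ u, (fun G : Env => 1 - cdf (G 0 : Measure ℝ) u) = fun G => rowTail u G 0 := by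
    intro u
    funext G
    rw [rowTail_eq]
  simp only [hb'] at htail2
  set q : ℝ → ℝ := fun u => ∫ G, rowTail u G 0 ∂P with hqdef
  set b : ℝ → ℝ := fun u => essSup (fun G : Env => rowTail u G 0) P with hbdef
  have hq0 : ∀ u, 0 ≤ q u := fun u => integral_nonneg fun G => rowTail_nonneg u G 0
  have hb : ∀ u, ∀ᵐ G ∂P, rowTail u G 0 ≤ b u := fun u =>
    ae_le_essSup (isBoundedUnder_of ⟨1, fun G => rowTail_le_one u G 0⟩)
  have hb0 : ∀ u, 0 ≤ b u := fun u => by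
    obtain ⟨G, hG⟩ := (hb u).exists
    exact (rowTail_nonneg u G 0).trans hG
  have hqanti : Antitone q := fun u u' h =>
    integral_mono (integrable_rowTail P u' 0) (integrable_rowTail P u 0) fun G =>
      measureReal_mono (Set.Ioi_subset_Ioi h)
  have hqm : Measurable fun u => ENNReal.ofReal (Real.sqrt (q u)) :=
    (Real.continuous_sqrt.measurable.comp hqanti.measurable).ennreal_ofReal
  -- The bound at a single level, with the optimal choice of the parameter.
  have hlevel : ∀ u i j, ∫⁻ w, ENNReal.ofReal (lpp (exceed u w) i j) ∂weightLaw P ≤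
      ENNReal.ofReal (8 * (i + j + 1)) *
        (2 * ENNReal.ofReal (b u) + ENNReal.ofReal (Real.sqrt (q u))) := by
    intro u i j
    have hsq := Real.sq_sqrt (hq0 u)
    have hs0 := Real.sqrt_nonneg (q u)
    have h1 : ∀ δ : ℝ, 0 < δ → ∫⁻ w, ENNReal.ofReal (lpp (exceed u w) i j) ∂weightLaw P ≤
        ENNReal.ofReal (8 * (i + j + 1) * (2 * b u + Real.sqrt (q u) + δ)) := by
      intro δ hδ
      refine lintegral_lpp_exceed_le hP (by linarith [hb0 u]) ?_ ?_ i j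
      · filter_upwards [hb u] with G hG
        linarith
      · change q u ≤ _
        have : Real.sqrt (q u) ≤ 2 * b u + Real.sqrt (q u) + δ := by linarith [hb0 u]
        calc q u = Real.sqrt (q u) ^ 2 := hsq.symm
          _ ≤ _ := pow_le_pow_left₀ hs0 this 2
    have h2 : Tendsto (fun δ : ℝ =>
        ENNReal.ofReal (8 * (i + j + 1) * (2 * b u + Real.sqrt (q u) + δ))) (𝓝[>] 0)
        (𝓝 (ENNReal.ofReal (8 * (i + j + 1) * (2 * b u + Real.sqrt (q u) + 0)))) := by
      refine (ENNReal.continuous_ofReal.comp ?_).continuousAt.tendsto.mono_left nhdsWithin_le_nhds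
      fun_prop
    have h3 := ge_of_tendsto h2 (eventually_mem_nhdsWithin.mono h1)
    refine h3.trans (le_of_eq ?_)
    rw [add_zero, ENNReal.ofReal_mul (by positivity),
      ENNReal.ofReal_add (by linarith [hb0 u]) hs0, ENNReal.ofReal_mul (by norm_num)]
    simp
  let f : ℝ → ENNReal := fun u => 2 * ENNReal.ofReal (b u) + ENNReal.ofReal (Real.sqrt (q u))
  have hf : ∫⁻ u in Set.Ioi (0 : ℝ), f u < ⊤ := by
    rw [lintegral_add_right _ hqm, lintegral_const_mul' _ _ (by simp)]
    exact ENNReal.add_lt_top.2 ⟨ENNReal.mul_lt_top (by simp) htail2, htail1⟩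
  have htail : Tendsto (fun n : ℕ => ∫⁻ u in Set.Ioi (n : ℝ), f u) atTop (𝓝 0) := by
    have h1 := tendsto_measure_iInter_atTop (μ := volume.withDensity f)
      (s := fun n : ℕ => Set.Ioi (n : ℝ)) (fun n => measurableSet_Ioi.nullMeasurableSet)
      (fun m n h => Set.Ioi_subset_Ioi (Nat.cast_le.2 h))
      ⟨0, by rw [withDensity_apply _ measurableSet_Ioi, Nat.cast_zero]; exact hf.ne⟩
    have h2 : ⋂ n : ℕ, Set.Ioi (n : ℝ) = ∅ := by
      ext x
      obtain ⟨n, hn⟩ := exists_nat_ge x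
      simp only [Set.mem_iInter, Set.mem_Ioi, Set.mem_empty_iff_false, iff_false, not_forall,
        not_lt]
      exact ⟨n, hn⟩
    rw [h2, measure_empty] at h1
    refine h1.congr fun n => ?_
    rw [Function.comp_apply, withDensity_apply _ measurableSet_Ioi]
  have hexcess : ∀ (K : ℝ) (i j : ℕ),
      ∫⁻ w, ENNReal.ofReal (lpp (fun z => max (w z - K) 0) i j) ∂weightLaw P ≤
        ENNReal.ofReal (8 * (i + j + 1)) * ∫⁻ u in Set.Ioi K, f u := by
    intro K i j
    calc ∫⁻ w, ENNReal.ofReal (lpp (fun z => max (w z - K) 0) i j) ∂weightLaw P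
        ≤ ∫⁻ w, (∫⁻ u in Set.Ioi K, ENNReal.ofReal (lpp (exceed u w) i j)) ∂weightLaw P :=
          lintegral_mono fun w => ofReal_lpp_excess_le_lintegral w K i j
      _ = ∫⁻ u in Set.Ioi K, ∫⁻ w, ENNReal.ofReal (lpp (exceed u w) i j) ∂weightLaw P := by
          refine lintegral_lintegral_swap ?_
          exact ((measurable_lpp i j).comp measurable_exceed).ennreal_ofReal.aemeasurable
      _ ≤ ∫⁻ u in Set.Ioi K, ENNReal.ofReal (8 * (i + j + 1)) * f u :=
          lintegral_mono fun u => hlevel u i j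
      _ = _ := lintegral_const_mul' _ _ ENNReal.ofReal_ne_top
  intro ε hε
  obtain ⟨n, hn⟩ := (htail.eventually (gt_mem_nhds
    (ENNReal.ofReal_pos.2 (by positivity : 0 < ε / 8)))).exists
  refine ⟨n, Nat.cast_nonneg n, fun i j => ?_⟩
  have hm : Measurable fun w : ℕ × ℕ → ℝ => lpp (fun z => max (w z - n) 0) i j :=
    (measurable_lpp i j).comp (measurable_pi_lambda _ fun z =>
      ((measurable_pi_apply z).sub_const _).max measurable_const)
  rw [integral_eq_lintegral_of_nonneg_ae (Eventually.of_forall fun w =>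
    lpp_nonneg (fun z => le_max_right _ _) i j) hm.aestronglyMeasurable]
  refine ENNReal.toReal_le_of_le_ofReal (by positivity) ((hexcess n i j).trans ?_)
  refine (mul_le_mul_right hn.le _).trans (le_of_eq ?_)
  rw [← ENNReal.ofReal_mul (by positivity)]
  congr 1
  ring

/-! ### Stationary fields -/

namespace IsErgodicField

variable {ν : Measure (ℕ × ℕ → ℝ)}

theorem translate (hν : IsErgodicField ν) (a b : ℕ) :
    MeasurePreserving (translate a b) ν ν := by
  have h1 : ∀ a, MeasurePreserving (LastPassage.translate a 0) ν ν := by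
    intro a
    induction a with
    | zero =>
      have : LastPassage.translate 0 0 = id := funext translate_zero
      rw [this]
      exact MeasurePreserving.id ν
    | succ a ih =>
      have : LastPassage.translate (a + 1) 0 =
          LastPassage.translate 1 0 ∘ LastPassage.translate a 0 := by
        funext w
        simp [translate_translate]
      rw [this]
      exact hν.right.comp ih
  induction b with
  | zero => exact h1 a
  | succ b ih =>
    have : LastPassage.translate a (b + 1) =
        LastPassage.translate 0 1 ∘ LastPassage.translate a b := by
      funext w
      simp [translate_translate]
    rw [this]
    exact hν.up.comp ih

theorem integral_comp_translate (hν : IsErgodicField ν) (a b : ℕ) {f : (ℕ × ℕ → ℝ) → ℝ}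
    (hf : Measurable f) : ∫ w, f (LastPassage.translate a b w) ∂ν = ∫ w, f w ∂ν := by
  have h := integral_map (μ := ν) (measurable_translate a b).aemeasurable (f := f)
    hf.aestronglyMeasurable
  rw [(hν.translate a b).map_eq] at h
  exact h.symm

theorem integrable_comp_translate (hν : IsErgodicField ν) (a b : ℕ) {f : (ℕ × ℕ → ℝ) → ℝ}
    (hf : Integrable f ν) : Integrable (fun w => f (LastPassage.translate a b w)) ν :=
  (hν.translate a b).integrable_comp_of_integrable hf

/-- An event which almost surely contains its preimages under both unit translations is
trivial. -/
theorem zero_or_one_of_imp [IsProbabilityMeasure ν] (hν : IsErgodicField ν)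
    {A : Set (ℕ × ℕ → ℝ)} (hA : MeasurableSet A)
    (h : ∀ a b, a ≤ 1 → b ≤ 1 → ∀ᵐ w ∂ν, LastPassage.translate a b w ∈ A → w ∈ A) :
    ν A = 0 ∨ ν A = 1 := by
  have key : ∀ a b, a ≤ 1 → b ≤ 1 → LastPassage.translate a b ⁻¹' A =ᵐ[ν] A := by
    intro a b ha hb
    refine ae_eq_of_ae_subset_of_measure_ge (h a b ha hb) ?_
      ((measurable_translate a b) hA).nullMeasurableSet (measure_ne_top ν _)
    exact ((hν.translate a b).measure_preimage hA.nullMeasurableSet).ge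
  exact hν.zero_or_one A hA (key 1 0 le_rfl zero_le_one) (key 0 1 zero_le_one le_rfl)

/-- An integrable function of the weights, seen from arbitrary positions, is negligible on the
linear scale: by Borel-Cantelli, since only the law of the function matters. -/
theorem ae_eventually_comp_translate_le [IsProbabilityMeasure ν] (hν : IsErgodicField ν)
    {f : (ℕ × ℕ → ℝ) → ℝ} (hf : Integrable f ν) (hfm : Measurable f) (hf0 : ∀ w, 0 ≤ f w)
    (a b : ℕ → ℕ) :
    ∀ᵐ w ∂ν, ∀ ε : ℝ, 0 < ε → ∀ᶠ n : ℕ in atTop,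
      f (LastPassage.translate (a n) (b n) w) ≤ ε * n := by
  have h1 : ∀ k : ℕ, ∀ᵐ w ∂ν, ∀ᶠ n : ℕ in atTop,
      f (LastPassage.translate (a n) (b n) w) ≤ 1 / ((k : ℝ) + 1) * n := by
    intro k
    have hk : (0 : ℝ) < k + 1 := by positivity
    let _ : MeasureSpace (ℕ × ℕ → ℝ) := ⟨ν⟩
    have : IsProbabilityMeasure (volume : Measure (ℕ × ℕ → ℝ)) := ‹IsProbabilityMeasure ν›
    have hsum := tsum_prob_mem_Ioi_lt_top (X := fun w => ((k : ℝ) + 1) * f w)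
      (hf.const_mul _) fun w => mul_nonneg hk.le (hf0 w)
    have hset : ∀ n : ℕ, ν {w | ((k : ℝ) + 1) * f (LastPassage.translate (a n) (b n) w) ∈
        Set.Ioi (n : ℝ)} = ν {w | ((k : ℝ) + 1) * f w ∈ Set.Ioi (n : ℝ)} := fun n =>
      (hν.translate (a n) (b n)).measure_preimage
        ((hfm.const_mul _) measurableSet_Ioi).nullMeasurableSet
    have hne : ∑' n : ℕ, ν {w | ((k : ℝ) + 1) * f (LastPassage.translate (a n) (b n) w) ∈
        Set.Ioi (n : ℝ)} ≠ ⊤ := by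
      simp only [hset]
      exact hsum.ne
    filter_upwards [ae_eventually_notMem hne] with w hw
    filter_upwards [hw] with n hn
    have hn' : ((k : ℝ) + 1) * f (LastPassage.translate (a n) (b n) w) ≤ n := not_lt.1 hn
    rw [div_mul_eq_mul_div, one_mul, le_div_iff₀ hk]
    linarith
  filter_upwards [ae_all_iff.2 h1] with w hw ε hε
  obtain ⟨k, hk⟩ := exists_nat_one_div_lt hε
  filter_upwards [hw k] with n hn
  exact hn.trans (mul_le_mul_of_nonneg_right hk.le n.cast_nonneg)

end IsErgodicField

theorem integrable_boxSum {ν : Measure (ℕ × ℕ → ℝ)} (hint : ∀ z, Integrable (fun w => w z) ν)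
    (K : ℕ) : Integrable (boxSum K) ν :=
  integrable_finsetSum _ fun z _ => (hint z).abs

/-- Integrated form of `superadditive_block_bound` for a stationary field observed from the points
`(p k, q k)`. -/
theorem integral_block_bound {ν : Measure (ℕ × ℕ → ℝ)} [IsProbabilityMeasure ν]
    (hν : IsErgodicField ν) (p q : ℕ → ℕ) {a : ℕ → ℕ → (ℕ × ℕ → ℝ) → ℝ}
    (ha0 : ∀ k w, 0 ≤ a k k w)
    (ha : ∀ k m n w, k ≤ m → m ≤ n → a k m w + a m n w ≤ a k n w)
    (haint : ∀ n, Integrable (a 0 n) ν)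
    {D : (ℕ × ℕ → ℝ) → ℝ} (hDm : Measurable D) (hDi : Integrable D ν) (hD : ∀ w, 0 ≤ D w)
    (hstep : ∀ k w, -D (translate (p k) (q k) w) ≤ a k (k + 1) w)
    {B : Set (ℕ × ℕ → ℝ)} (hB : MeasurableSet B) {N : ℕ} {c : ℝ}
    (hgood : ∀ k w, translate (p k) (q k) w ∉ B → ∃ n, 1 ≤ n ∧ n ≤ N ∧ n * c ≤ a k (k + n) w)
    (M : ℕ) :
    M * (c - ∫ w in B, (D w + |c|) ∂ν) - N * ∫ w, (D w + |c|) ∂ν ≤ ∫ w, a 0 M w ∂ν := by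
  have hEm : Measurable fun w => D w + |c| := hDm.add_const _
  have hEi : Integrable (fun w => D w + |c|) ν := hDi.add (integrable_const _)
  have hE0 : ∀ w, 0 ≤ D w + |c| := fun w => add_nonneg (hD w) (abs_nonneg c)
  have hBi : Integrable (B.indicator fun w => D w + |c|) ν := hEi.indicator hB
  have hpt : ∀ w, M * c - ∑ k ∈ Finset.range M,
      B.indicator (fun w => D w + |c|) (translate (p k) (q k) w) -
      ∑ k ∈ Finset.Ico (M - N) M, (D (translate (p k) (q k) w) + |c|) ≤ a 0 M w := fun w =>
    superadditive_block_bound (a := fun k n => a k n w) (fun k => ha0 k w)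
      (fun k m n => ha k m n w) (D := fun k => D (translate (p k) (q k) w)) (fun k => hD _)
      (fun k => hstep k w) (bad := {k | translate (p k) (q k) w ∈ B}) (fun k => hgood k w) M
  have hi1 : Integrable (fun w => ∑ k ∈ Finset.range M,
      B.indicator (fun w => D w + |c|) (translate (p k) (q k) w)) ν :=
    integrable_finsetSum _ fun k _ => hν.integrable_comp_translate (p k) (q k) hBi
  have hi2 : Integrable (fun w => ∑ k ∈ Finset.Ico (M - N) M,
      (D (translate (p k) (q k) w) + |c|)) ν :=
    integrable_finsetSum _ fun k _ => hν.integrable_comp_translate (p k) (q k) hEi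
  have h3 : Integrable (fun w => M * c - ∑ k ∈ Finset.range M,
      B.indicator (fun w => D w + |c|) (translate (p k) (q k) w)) ν :=
    (integrable_const _).sub hi1
  have h4 := integral_mono (h3.sub hi2) (haint M) hpt
  have h5 : ∫ w, ((fun w => M * c - ∑ k ∈ Finset.range M,
      B.indicator (fun w => D w + |c|) (translate (p k) (q k) w)) - fun w =>
      ∑ k ∈ Finset.Ico (M - N) M, (D (translate (p k) (q k) w) + |c|)) w ∂ν =
      M * c - M * (∫ w in B, (D w + |c|) ∂ν) -
        ((M - (M - N) : ℕ) : ℝ) * ∫ w, (D w + |c|) ∂ν := by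
    simp only [Pi.sub_apply]
    rw [integral_sub h3 hi2, integral_sub (integrable_const _) hi1,
      integral_finsetSum _ fun k _ => hν.integrable_comp_translate (p k) (q k) hBi,
      integral_finsetSum _ fun k _ => hν.integrable_comp_translate (p k) (q k) hEi]
    simp only [hν.integral_comp_translate _ _ (hEm.indicator hB),
      hν.integral_comp_translate _ _ hEm, integral_indicator hB, Finset.sum_const,
      Finset.card_range, Nat.card_Ico, nsmul_eq_mul, integral_const, probReal_univ, one_smul]
  have h6 : ((M - (M - N) : ℕ) : ℝ) * ∫ w, (D w + |c|) ∂ν ≤ N * ∫ w, (D w + |c|) ∂ν := by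
    refine mul_le_mul_of_nonneg_right (Nat.cast_le.2 (by omega)) (integral_nonneg hE0)
  rw [h5] at h4
  linarith

/-! ### Lattice points along a ray -/

theorem floor_add_mul (x : ℝ) (hx : 0 < x) (k n : ℕ) :
    ⌊(k : ℝ) * x⌋₊ + ⌊(n : ℝ) * x⌋₊ ≤ ⌊((k + n : ℕ) : ℝ) * x⌋₊ ∧
      ⌊((k + n : ℕ) : ℝ) * x⌋₊ ≤ ⌊(k : ℝ) * x⌋₊ + ⌊(n : ℝ) * x⌋₊ + 1 := by
  have hk : 0 ≤ (k : ℝ) * x := by positivity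
  have hn : 0 ≤ (n : ℝ) * x := by positivity
  have h1 := Nat.floor_le hk
  have h2 := Nat.floor_le hn
  have h3 := Nat.lt_floor_add_one ((k : ℝ) * x)
  have h4 := Nat.lt_floor_add_one ((n : ℝ) * x)
  push_cast
  constructor
  · refine Nat.le_floor ?_
    push_cast
    linarith
  · refine Nat.lt_succ_iff.1 ((Nat.floor_lt (by positivity)).2 ?_)
    push_cast
    linarith

theorem floor_mul_mono (x : ℝ) (hx : 0 < x) {k n : ℕ} (h : k ≤ n) :
    ⌊(k : ℝ) * x⌋₊ ≤ ⌊(n : ℝ) * x⌋₊ :=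
  Nat.floor_mono (mul_le_mul_of_nonneg_right (Nat.cast_le.2 h) hx.le)

/-- The last-passage times along the ray through `(x, y)`. -/
noncomputable def rayTime (x y : ℝ) (n : ℕ) (w : ℕ × ℕ → ℝ) : ℝ :=
  lpp w ⌊(n : ℝ) * x⌋₊ ⌊(n : ℝ) * y⌋₊

theorem measurable_rayTime (x y : ℝ) (n : ℕ) : Measurable (rayTime x y n) := measurable_lpp _ _

/-- A weak-type maximal inequality for the sums of a nonnegative function of the weights along a
ray, in positive-probability form: if the mean is small, then with positive probability all
sums are small. The points of the ray are additive only up to an error of one in each coordinate,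
which is absorbed by summing the function over four neighbouring positions. -/
theorem measure_forall_sum_lt_ne_zero {ν : Measure (ℕ × ℕ → ℝ)} [IsProbabilityMeasure ν]
    (hν : IsErgodicField ν) {x y : ℝ} (hx : 0 < x) (hy : 0 < y) {h : (ℕ × ℕ → ℝ) → ℝ}
    (hm : Measurable h) (hi : Integrable h ν) (h0 : ∀ w, 0 ≤ h w) {c : ℝ}
    (hc : 4 * ∫ w, h w ∂ν < c) :
    ν {w | ∀ n : ℕ, 1 ≤ n → ∑ i ∈ Finset.range n,
      h (translate ⌊(i : ℝ) * x⌋₊ ⌊(i : ℝ) * y⌋₊ w) < n * c} ≠ 0 := by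
  have hI0 : 0 ≤ ∫ w, h w ∂ν := integral_nonneg h0
  have hc0 : 0 < c := by linarith
  let p : ℕ → ℕ := fun i => ⌊(i : ℝ) * x⌋₊
  let q : ℕ → ℕ := fun i => ⌊(i : ℝ) * y⌋₊
  let S : ℕ → (ℕ × ℕ → ℝ) → ℝ := fun n w => ∑ i ∈ Finset.range n, h (translate (p i) (q i) w)
  let A : Set (ℕ × ℕ → ℝ) := {w | ∀ n : ℕ, 1 ≤ n → S n w < n * c}
  let B : ℕ → Set (ℕ × ℕ → ℝ) := fun N => {w | ∀ n : ℕ, 1 ≤ n → n ≤ N → S n w < n * c}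
  have hSm : ∀ n, Measurable (S n) := fun n =>
    Finset.measurable_sum _ fun i _ => hm.comp (measurable_translate _ _)
  have hBm : ∀ N, MeasurableSet (B N) := by
    intro N
    refine measurableSet_setOfPred.2 (Measurable.forall fun n => ?_)
    refine Measurable.imp measurable_const (Measurable.imp measurable_const ?_)
    exact measurableSet_setOfPred.1 (measurableSet_lt (hSm n) measurable_const)
  -- The function summed over four neighbouring positions.
  let h' : (ℕ × ℕ → ℝ) → ℝ := fun w =>
    ∑ e ∈ Finset.range 2 ×ˢ Finset.range 2, h (translate e.1 e.2 w)
  have h'm : Measurable h' := Finset.measurable_sum _ fun e _ => hm.comp (measurable_translate _ _)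
  have h'i : Integrable h' ν :=
    integrable_finsetSum _ fun e _ => hν.integrable_comp_translate e.1 e.2 hi
  have h'0 : ∀ w, 0 ≤ h' w := fun w => Finset.sum_nonneg fun e _ => h0 _
  have h'I : ∫ w, h' w ∂ν = 4 * ∫ w, h w ∂ν := by
    simp only [h']
    rw [integral_finsetSum _ fun e _ => hν.integrable_comp_translate e.1 e.2 hi]
    simp only [hν.integral_comp_translate _ _ hm]
    simp
  have hnear : ∀ k i w, h (translate (p i + 1) (q i + 1) (translate (p k) (q k) w)) ≤
      h' (translate (p (k + i)) (q (k + i)) w) := by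
    intro k i w
    obtain ⟨h1, h2⟩ := floor_add_mul x hx k i
    obtain ⟨h3, h4⟩ := floor_add_mul y hy k i
    have h5 : translate (p i + 1) (q i + 1) (translate (p k) (q k) w) =
        translate (p k + p i + 1 - p (k + i)) (q k + q i + 1 - q (k + i))
          (translate (p (k + i)) (q (k + i)) w) := by
      rw [translate_translate, translate_translate]
      congr 1 <;> simp only [p, q] <;> omega
    rw [h5]
    refine Finset.single_le_sum (f := fun e : ℕ × ℕ =>
      h (translate e.1 e.2 (translate (p (k + i)) (q (k + i)) w)))
      (a := (p k + p i + 1 - p (k + i), q k + q i + 1 - q (k + i))) (fun e _ => h0 _) ?_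
    simp only [Finset.mem_product, Finset.mem_range, p, q]
    omega
  have hbound : ∀ N M : ℕ, (M : ℝ) * (c - ν.real (translate 1 1 ⁻¹' B N) * c) - N * c ≤
      M * (4 * ∫ w, h w ∂ν) := by
    intro N M
    have h1 := integral_block_bound hν p q
      (a := fun k n w => ∑ i ∈ Finset.Ico k n, h' (translate (p i) (q i) w))
      (fun k w => by simp)
      (fun k m n w hkm hmn => (Finset.sum_Ico_consecutive _ hkm hmn).le)
      (fun n => integrable_finsetSum _ fun i _ => hν.integrable_comp_translate _ _ h'i)
      (D := fun _ => 0) measurable_const (integrable_const _) (fun _ => le_rfl)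
      (fun k w => by simpa using h'0 _)
      (B := translate 1 1 ⁻¹' B N) (measurable_translate 1 1 (hBm N)) (N := N) (c := c)
      (fun k w hw => by
        simp only [B, Set.mem_preimage, Set.mem_ofPred_eq, not_forall, not_lt] at hw
        obtain ⟨n, hn1, hnN, hn⟩ := hw
        refine ⟨n, hn1, hnN, hn.trans ?_⟩
        rw [Finset.sum_Ico_eq_sum_range, Nat.add_sub_cancel_left]
        refine Finset.sum_le_sum fun i _ => ?_
        have := hnear k i w
        rw [translate_translate (p i) (q i) 1 1, add_comm 1, add_comm 1]
        exact this) M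
    have h2 : ∫ w, ∑ i ∈ Finset.Ico 0 M, h' (translate (p i) (q i) w) ∂ν =
        M * (4 * ∫ w, h w ∂ν) := by
      rw [integral_finsetSum _ fun i _ => hν.integrable_comp_translate _ _ h'i]
      simp only [hν.integral_comp_translate _ _ h'm, h'I]
      simp
    rw [h2] at h1
    simpa [abs_of_pos hc0, measureReal_def] using h1
  have hreal : ∀ N, ν.real (translate 1 1 ⁻¹' B N) = ν.real (B N) := fun N => by
    rw [measureReal_def, (hν.translate 1 1).measure_preimage (hBm N).nullMeasurableSet,
      measureReal_def]
  simp only [hreal] at hbound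
  have hBlow : ∀ N, 1 - (4 * ∫ w, h w ∂ν) / c ≤ ν.real (B N) := by
    intro N
    by_contra hcon
    have hcon' : 0 < c - ν.real (B N) * c - 4 * ∫ w, h w ∂ν := by
      have : ν.real (B N) < 1 - (4 * ∫ w, h w ∂ν) / c := not_le.1 hcon
      have h2 := mul_lt_mul_of_pos_right this hc0
      rw [sub_mul, div_mul_cancel₀ _ hc0.ne'] at h2
      linarith
    obtain ⟨M, hM⟩ := exists_nat_gt (N * c / (c - ν.real (B N) * c - 4 * ∫ w, h w ∂ν))
    rw [div_lt_iff₀ hcon'] at hM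
    linarith [hbound N M]
  have hanti : Antitone B := fun N N' hN w hw n hn hnN => hw n hn (hnN.trans hN)
  have hAB : A = ⋂ N, B N := by
    ext w
    simp only [Set.mem_iInter, A, B, Set.mem_ofPred_eq]
    exact ⟨fun hw N n hn _ => hw n hn, fun hw n hn => hw n n hn le_rfl⟩
  have hlim := tendsto_measure_iInter_atTop (μ := ν) (fun N => (hBm N).nullMeasurableSet) hanti
    ⟨0, measure_ne_top ν _⟩
  rw [← hAB] at hlim
  intro hzero
  have hzero' : ν A = 0 := hzero
  rw [hzero'] at hlim
  have hlim' := (ENNReal.tendsto_toReal ENNReal.zero_ne_top).comp hlim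
  have hle : 1 - (4 * ∫ w, h w ∂ν) / c ≤ (0 : ENNReal).toReal :=
    ge_of_tendsto' hlim' hBlow
  have : (4 * ∫ w, h w ∂ν) / c < 1 := (div_lt_one hc0).2 hc
  simp only [ENNReal.toReal_zero] at hle
  linarith

/-! ### Mean last-passage times -/

/-- The mean last-passage time from the origin to `(i, j)`. -/
noncomputable def meanLpp (ν : Measure (ℕ × ℕ → ℝ)) (i j : ℕ) : ℝ := ∫ w, lpp w i j ∂ν

section Mean

variable {ν : Measure (ℕ × ℕ → ℝ)} (hν : IsErgodicField ν)
  (hint : ∀ z, Integrable (fun w => w z) ν)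

include hν hint

theorem meanLpp_add_le (a b i j : ℕ) :
    meanLpp ν a b + meanLpp ν i j ≤ meanLpp ν (a + i) (b + j) := by
  have h1 := integral_mono ((integrable_lpp hint a b).add
    (hν.integrable_comp_translate a b (integrable_lpp hint i j)))
    (integrable_lpp hint (a + i) (b + j)) fun w => lpp_add_le w a b i j
  have h2 : ∫ w, ((fun w => lpp w a b) + fun w => lpp (translate a b w) i j) w ∂ν =
      meanLpp ν a b + meanLpp ν i j := by
    simp only [Pi.add_apply]
    rw [integral_add (integrable_lpp hint a b)
      (hν.integrable_comp_translate a b (integrable_lpp hint i j)),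
      hν.integral_comp_translate a b (measurable_lpp i j)]
    rfl
  rw [h2] at h1
  exact h1

/-- Up to an additive constant the means are monotone between points at bounded distance. -/
theorem meanLpp_sub_le {K a b i j : ℕ} (hai : a ≤ i) (hbj : b ≤ j)
    (hi : i < a + K) (hj : j < b + K) :
    meanLpp ν a b - 2 * ∫ w, boxSum K w ∂ν ≤ meanLpp ν i j := by
  have hb := (hν.integrable_comp_translate a b (integrable_boxSum hint K)).const_mul 2
  have h1 := integral_mono ((integrable_lpp hint a b).sub hb) (integrable_lpp hint i j)
    fun w => lpp_sub_boxSum_le w hai hbj hi hj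
  have h2 : ∫ w, ((fun w => lpp w a b) - fun w => 2 * boxSum K (translate a b w)) w ∂ν =
      meanLpp ν a b - 2 * ∫ w, boxSum K w ∂ν := by
    simp only [Pi.sub_apply]
    rw [integral_sub (integrable_lpp hint a b) hb, integral_const_mul,
      hν.integral_comp_translate a b (measurable_boxSum K)]
    rfl
  rw [h2] at h1
  exact h1

omit hν in
theorem integrable_lpp_excess [IsProbabilityMeasure ν] (K : ℝ) (i j : ℕ) :
    Integrable (fun w => lpp (fun z => max (w z - K) 0) i j) ν := by
  have hΦ : Measurable fun (w : ℕ × ℕ → ℝ) z => max (w z - K) 0 :=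
    measurable_pi_lambda _ fun z => ((measurable_pi_apply z).sub_const _).max measurable_const
  have h1 : ∀ z, Integrable (fun w => w z) (ν.map fun w z => max (w z - K) 0) := by
    intro z
    rw [integrable_map_measure (measurable_pi_apply z).aestronglyMeasurable hΦ.aemeasurable]
    exact ((hint z).sub (integrable_const K)).sup (integrable_const 0)
  have h2 := integrable_lpp h1 i j
  rw [integrable_map_measure (measurable_lpp i j).aestronglyMeasurable hΦ.aemeasurable] at h2
  exact h2

/-- Fekete's lemma for the means along a ray, corrected by a constant for the failure of additivity
of the points of the ray. -/
theorem exists_tendsto_meanLpp_ray [IsProbabilityMeasure ν] (hS : HasSmallExcess ν) {x y : ℝ}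
    (hx : 0 < x) (hy : 0 < y) :
    ∃ γ : ℝ, Tendsto (fun n : ℕ => meanLpp ν ⌊(n : ℝ) * x⌋₊ ⌊(n : ℝ) * y⌋₊ / n) atTop (𝓝 γ) := by
  set e : ℕ → ℝ := fun n => meanLpp ν ⌊(n : ℝ) * x⌋₊ ⌊(n : ℝ) * y⌋₊ with he
  set C : ℝ := 2 * ∫ w, boxSum 2 w ∂ν with hC
  have hsub : Subadditive fun n => C - e n := by
    intro m n
    obtain ⟨h1, h2⟩ := floor_add_mul x hx m n
    obtain ⟨h3, h4⟩ := floor_add_mul y hy m n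
    have h5 := meanLpp_add_le hν hint ⌊(m : ℝ) * x⌋₊ ⌊(m : ℝ) * y⌋₊ ⌊(n : ℝ) * x⌋₊ ⌊(n : ℝ) * y⌋₊
    have h6 := meanLpp_sub_le hν hint (K := 2) h1 h3 (by omega) (by omega)
    change C - e (m + n) ≤ C - e m + (C - e n)
    simp only [he]
    linarith
  -- Truncation at a fixed level gives a linear upper bound for the means.
  obtain ⟨K, hK0, hK⟩ := hS 1 one_pos
  have hup : ∀ i j, meanLpp ν i j ≤ K * (i + j) + (i + j + 1) := by
    intro i j
    have h1 := integral_mono (integrable_lpp hint i j)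
      ((integrable_const (K * (i + j))).add (integrable_lpp_excess hint K i j)) fun w => by
        refine (lpp_le_lpp_add w (fun z => min (w z) K)
          (u := fun z => max (w z - K) 0) (fun z => ?_) i j).trans
          (add_le_add_left (lpp_le_of_le (fun z => min_le_right _ _) i j) _)
        rcases le_total (w z) K with h | h
        · simp [h]
        · simp [h]
    have h2 : ∫ w, (K * ((i : ℝ) + j) + lpp (fun z => max (w z - K) 0) i j) ∂ν ≤
        K * (i + j) + (i + j + 1) := by
      rw [integral_add (integrable_const _) (integrable_lpp_excess hint K i j)]
      have := hK i j
      simp only [integral_const, probReal_univ, one_smul]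
      linarith
    exact h1.trans h2
  have hbdd : BddBelow (Set.range fun n : ℕ => (C - e n) / n) := by
    refine ⟨-(K * (x + y) + (x + y + 1)), ?_⟩
    rintro _ ⟨n, rfl⟩
    rcases Nat.eq_zero_or_pos n with rfl | hn
    · simp only [CharP.cast_eq_zero, div_zero, Left.neg_nonpos_iff]
      positivity
    have hn' : (1 : ℝ) ≤ n := Nat.one_le_cast.2 hn
    have hC0 : 0 ≤ C := mul_nonneg zero_le_two (integral_nonneg fun w => boxSum_nonneg 2 w)
    have h1 := hup ⌊(n : ℝ) * x⌋₊ ⌊(n : ℝ) * y⌋₊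
    have h2 := Nat.floor_le (by positivity : 0 ≤ (n : ℝ) * x)
    have h3 := Nat.floor_le (by positivity : 0 ≤ (n : ℝ) * y)
    dsimp only
    rw [le_div_iff₀ (by linarith)]
    have h4 : K * ((⌊(n : ℝ) * x⌋₊ : ℝ) + ⌊(n : ℝ) * y⌋₊) ≤ K * (n * x + n * y) :=
      mul_le_mul_of_nonneg_left (add_le_add h2 h3) hK0
    simp only [he]
    linarith
  have h := hsub.tendsto_lim hbdd
  refine ⟨0 - hsub.lim, ?_⟩
  have h0 : Tendsto (fun n : ℕ => C / (n : ℝ)) atTop (𝓝 0) :=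
    tendsto_const_div_atTop_nhds_zero_nat C
  refine (h0.sub h).congr fun n => ?_
  ring

end Mean

/-! ### Zero-one laws for the growth rate -/

/-- The weights for which the last-passage times along the ray have, along the filter-like
quantifier `Q` (`∀ᶠ` or `∃ᶠ` at infinity), growth rate at least `c`. -/
def rateSet (Q : (ℕ → Prop) → Prop) (x y c : ℝ) : Set (ℕ × ℕ → ℝ) :=
  {w | ∀ k : ℕ, Q fun n => (n : ℝ) * (c - 1 / ((k : ℝ) + 1)) ≤ rayTime x y n w}

theorem measurableSet_rateSet_frequently (x y c : ℝ) :
    MeasurableSet (rateSet (fun p => ∃ᶠ n in atTop, p n) x y c) := by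
  simp only [rateSet, frequently_atTop]
  refine measurableSet_setOfPred.2 (Measurable.forall fun k => Measurable.forall fun m =>
    Measurable.exists fun n => Measurable.and measurable_const ?_)
  exact measurableSet_setOfPred.1 (measurableSet_le measurable_const (measurable_rayTime x y n))

theorem measurableSet_rateSet_eventually (x y c : ℝ) :
    MeasurableSet (rateSet (fun p => ∀ᶠ n in atTop, p n) x y c) := by
  simp only [rateSet, eventually_atTop]
  refine measurableSet_setOfPred.2 (Measurable.forall fun k => Measurable.exists fun m =>
    Measurable.forall fun n => Measurable.imp measurable_const ?_)
  exact measurableSet_setOfPred.1 (measurableSet_le measurable_const (measurable_rayTime x y n))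

section Rate

variable {ν : Measure (ℕ × ℕ → ℝ)} [IsProbabilityMeasure ν] (hν : IsErgodicField ν)
  (hint : ∀ z, Integrable (fun w => w z) ν) {x y : ℝ} (hx : 0 < x) (hy : 0 < y)

include hν hint hx hy

/-- A path for the translated weights extends, by boundedly many steps at either end, to a path
for the original weights which ends on the ray. -/
theorem ae_rayTime_translate_le {a b : ℕ} (ha : a ≤ 1) (hb : b ≤ 1) :
    ∃ L : ℕ, ∀ᵐ w ∂ν, ∀ c ε : ℝ, 0 < ε → ∀ᶠ n : ℕ in atTop,
      n * c ≤ rayTime x y n (translate a b w) →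
        ((n + L : ℕ) : ℝ) * (c - ε) ≤ rayTime x y (n + L) w := by
  obtain ⟨L1, hL1⟩ := exists_nat_ge (1 / x)
  obtain ⟨L2, hL2⟩ := exists_nat_ge (1 / y)
  set L := max L1 L2 with hL
  have hLx : 1 ≤ ⌊(L : ℝ) * x⌋₊ := by
    refine Nat.le_floor ?_
    have : (L1 : ℝ) ≤ L := Nat.cast_le.2 (le_max_left _ _)
    rw [div_le_iff₀ hx] at hL1
    push_cast
    nlinarith
  have hLy : 1 ≤ ⌊(L : ℝ) * y⌋₊ := by
    refine Nat.le_floor ?_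
    have : (L2 : ℝ) ≤ L := Nat.cast_le.2 (le_max_right _ _)
    rw [div_le_iff₀ hy] at hL2
    push_cast
    nlinarith
  set K := ⌊(L : ℝ) * x⌋₊ + ⌊(L : ℝ) * y⌋₊ + 2 with hK
  refine ⟨L, ?_⟩
  filter_upwards [hν.ae_eventually_comp_translate_le (integrable_boxSum hint K)
    (measurable_boxSum K) (boxSum_nonneg K) (fun n => a + ⌊(n : ℝ) * x⌋₊)
    (fun n => b + ⌊(n : ℝ) * y⌋₊)] with w hw c ε hε
  obtain ⟨n₀, hn₀⟩ := exists_nat_gt ((2 * boxSum 2 w + L * |c - ε|) / (ε / 2))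
  rw [div_lt_iff₀ (by positivity)] at hn₀
  filter_upwards [hw (ε / 4) (by positivity), eventually_ge_atTop n₀] with n hn hnn h
  obtain ⟨h1, h2⟩ := floor_add_mul x hx n L
  obtain ⟨h3, h4⟩ := floor_add_mul y hy n L
  have h5 := lpp_add_le w a b ⌊(n : ℝ) * x⌋₊ ⌊(n : ℝ) * y⌋₊
  have h6 := lpp_sub_boxSum_le w (K := K) (a := a + ⌊(n : ℝ) * x⌋₊) (b := b + ⌊(n : ℝ) * y⌋₊)
    (i := ⌊((n + L : ℕ) : ℝ) * x⌋₊) (j := ⌊((n + L : ℕ) : ℝ) * y⌋₊)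
    (by omega) (by omega) (by omega) (by omega)
  have h7 := neg_boxSum_le_lpp w (K := 2) (i := a) (j := b) (by omega) (by omega)
  have h8 : (n₀ : ℝ) ≤ n := Nat.cast_le.2 hnn
  have h9 : (L : ℝ) * (c - ε) ≤ L * |c - ε| :=
    mul_le_mul_of_nonneg_left (le_abs_self _) L.cast_nonneg
  simp only [rayTime] at h ⊢
  push_cast at h6 ⊢
  have h10 : (n₀ : ℝ) * (ε / 2) ≤ n * (ε / 2) := mul_le_mul_of_nonneg_right h8 (by positivity)
  nlinarith

/-- The growth rate is almost surely invariant under translations, hence obeys a zero-one law. -/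
theorem measure_rateSet_zero_or_one {Q : (ℕ → Prop) → Prop} (c : ℝ)
    (hQm : MeasurableSet (rateSet Q x y c))
    (hQ : ∀ (L : ℕ) (p r : ℕ → Prop), (∀ᶠ n in atTop, p n → r (n + L)) → Q p → Q r) :
    ν (rateSet Q x y c) = 0 ∨ ν (rateSet Q x y c) = 1 := by
  refine hν.zero_or_one_of_imp hQm fun a b ha hb => ?_
  obtain ⟨L, hL⟩ := ae_rayTime_translate_le hν hint hx hy ha hb
  filter_upwards [hL] with w hw hmem k
  have hε : (0 : ℝ) < 1 / ((k : ℝ) + 1) / 2 := by positivity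
  obtain ⟨l, hl⟩ := exists_nat_one_div_lt hε
  refine hQ L _ _ ?_ (hmem l)
  filter_upwards [hw (c - 1 / ((l : ℝ) + 1)) _ hε] with n hn hle
  refine le_trans ?_ (hn hle)
  refine mul_le_mul_of_nonneg_left ?_ (Nat.cast_nonneg _)
  linarith

theorem measure_rateSet_frequently (c : ℝ) :
    ν (rateSet (fun p => ∃ᶠ n in atTop, p n) x y c) = 0 ∨
      ν (rateSet (fun p => ∃ᶠ n in atTop, p n) x y c) = 1 := by
  refine measure_rateSet_zero_or_one hν hint hx hy c (measurableSet_rateSet_frequently x y c) ?_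
  intro L p r h hp
  exact (tendsto_add_atTop_nat L).frequently (hp.mp h)

theorem measure_rateSet_eventually (c : ℝ) :
    ν (rateSet (fun p => ∀ᶠ n in atTop, p n) x y c) = 0 ∨
      ν (rateSet (fun p => ∀ᶠ n in atTop, p n) x y c) = 1 := by
  refine measure_rateSet_zero_or_one hν hint hx hy c (measurableSet_rateSet_eventually x y c) ?_
  intro L p r h hp
  have h1 : ∀ᶠ n in atTop, r (n + L) := hp.mp h
  rw [← map_add_atTop_eq_nat L]
  exact eventually_map.2 h1

/-! ### The upper bound -/

/-- If the growth rate is at least `c` infinitely often, then long paths can be cut into blocks of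
slope almost `c`, so that the means grow at least at rate `c`. -/
theorem le_of_rateSet_frequently {γ c : ℝ}
    (hγ : Tendsto (fun n : ℕ => meanLpp ν ⌊(n : ℝ) * x⌋₊ ⌊(n : ℝ) * y⌋₊ / n) atTop (𝓝 γ))
    (h1 : ν (rateSet (fun p => ∃ᶠ n in atTop, p n) x y c) = 1) : c ≤ γ := by
  refine le_of_forall_pos_sub_le fun ε hε => ?_
  set c' := c - ε / 2 with hc'
  let p : ℕ → ℕ := fun i => ⌊(i : ℝ) * x⌋₊
  let q : ℕ → ℕ := fun i => ⌊(i : ℝ) * y⌋₊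
  have hpmono : ∀ {k n}, k ≤ n → p k ≤ p n := fun h => floor_mul_mono x hx h
  have hqmono : ∀ {k n}, k ≤ n → q k ≤ q n := fun h => floor_mul_mono y hy h
  -- The weights for which no block of length at most `N` is good.
  let good : ℕ → (ℕ × ℕ → ℝ) → Prop := fun n w =>
    ∀ e ∈ Finset.range 2 ×ˢ Finset.range 2, n * c' ≤ lpp w (p n + e.1) (q n + e.2)
  let B : ℕ → Set (ℕ × ℕ → ℝ) := fun N => {w | ∀ n : ℕ, 1 ≤ n → n ≤ N → ¬ good n w}
  have hgoodm : ∀ n, MeasurableSet {w | good n w} := fun n =>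
    measurableSet_setOfPred.2 (Measurable.forall fun e => Measurable.imp measurable_const
      (measurableSet_setOfPred.1 (measurableSet_le measurable_const (measurable_lpp _ _))))
  have hBm : ∀ N, MeasurableSet (B N) := fun N =>
    measurableSet_setOfPred.2 (Measurable.forall fun n => Measurable.imp measurable_const
      (Measurable.imp measurable_const (measurableSet_setOfPred.1 (hgoodm n)).not))
  have hae : ∀ᵐ w ∂ν, ∃ n, 1 ≤ n ∧ good n w := by
    have hmem : ∀ᵐ w ∂ν, w ∈ rateSet (fun p => ∃ᶠ n in atTop, p n) x y c :=
      (prob_compl_eq_zero_iff (measurableSet_rateSet_frequently x y c)).2 h1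
    filter_upwards [hmem, hν.ae_eventually_comp_translate_le (integrable_boxSum hint 2)
      (measurable_boxSum 2) (boxSum_nonneg 2) p q] with w hw hbox
    obtain ⟨k, hk⟩ := exists_nat_one_div_lt (by positivity : 0 < ε / 4)
    obtain ⟨n, hn, hn1, hnb⟩ := ((hw k).and_eventually
      ((eventually_ge_atTop 1).and (hbox (ε / 8) (by positivity)))).exists
    refine ⟨n, hn1, fun e he => ?_⟩
    simp only [Finset.mem_product, Finset.mem_range] at he
    have h2 := lpp_sub_boxSum_le w (K := 2) (a := p n) (b := q n) (i := p n + e.1)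
      (j := q n + e.2) (by omega) (by omega) (by omega) (by omega)
    have h3 : (n : ℝ) * (c - ε / 4) ≤ n * (c - 1 / ((k : ℝ) + 1)) :=
      mul_le_mul_of_nonneg_left (by linarith) n.cast_nonneg
    have h4 : rayTime x y n w = lpp w (p n) (q n) := rfl
    rw [h4] at hn
    rw [hc']
    linarith
  set K := ⌊x⌋₊ + ⌊y⌋₊ + 2 with hK
  let D : (ℕ × ℕ → ℝ) → ℝ := fun w => 2 * boxSum K w
  have hDm : Measurable D := (measurable_boxSum K).const_mul 2
  have hDi : Integrable D ν := (integrable_boxSum hint K).const_mul 2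
  have hEi : Integrable (fun w => D w + |c'|) ν := hDi.add (integrable_const _)
  have hanti : Antitone B := fun N N' hN w hw n hn hnN => hw n hn (hnN.trans hN)
  have hlim : Tendsto (fun N => ∫ w in B N, (D w + |c'|) ∂ν) atTop (𝓝 0) := by
    have h2 := tendsto_setIntegral_of_antitone (μ := ν) hBm hanti ⟨0, hEi.integrableOn⟩
    have h3 : ν (⋂ N, B N) = 0 := by
      refine measure_mono_null ?_ hae
      intro w hw
      simp only [Set.mem_iInter] at hw
      rintro ⟨n, hn1, hn⟩
      exact hw n n hn1 le_rfl hn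
    rwa [setIntegral_measure_zero _ h3] at h2
  obtain ⟨N, hN⟩ := (hlim.eventually (gt_mem_nhds (by positivity : 0 < ε / 2))).exists
  have hblock : ∀ M : ℕ, (M : ℝ) * (c' - ∫ w in B N, (D w + |c'|) ∂ν) -
      N * ∫ w, (D w + |c'|) ∂ν ≤ meanLpp ν (p M) (q M) := by
    intro M
    have h2 := integral_block_bound hν p q
      (a := fun k n w => lpp (translate (p k) (q k) w) (p n - p k) (q n - q k))
      (fun k w => by simp)
      (fun k m n w hkm hmn => by
        have h3 := lpp_add_le (translate (p k) (q k) w) (p m - p k) (q m - q k)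
          (p n - p m) (q n - q m)
        have e1 := hpmono hkm
        have e2 := hpmono hmn
        have e3 := hqmono hkm
        have e4 := hqmono hmn
        rwa [translate_translate, Nat.add_sub_cancel' e1, Nat.add_sub_cancel' e3,
          show p m - p k + (p n - p m) = p n - p k by omega,
          show q m - q k + (q n - q m) = q n - q k by omega] at h3)
      (fun n => hν.integrable_comp_translate (p 0) (q 0) (integrable_lpp hint _ _))
      hDm hDi (fun w => mul_nonneg zero_le_two (boxSum_nonneg K w))
      (fun k w => by
        obtain ⟨e1, e2⟩ := floor_add_mul x hx k 1
        obtain ⟨e3, e4⟩ := floor_add_mul y hy k 1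
        simp only [Nat.cast_one, one_mul] at e1 e2 e3 e4
        exact neg_boxSum_le_lpp _ (by simp only [p]; omega) (by simp only [q]; omega))
      (hBm N) (N := N) (c := c')
      (fun k w hw => by
        simp only [B, Set.mem_ofPred_eq, not_forall, not_not] at hw
        obtain ⟨n, hn1, hnN, hn⟩ := hw
        refine ⟨n, hn1, hnN, ?_⟩
        obtain ⟨e1, e2⟩ := floor_add_mul x hx k n
        obtain ⟨e3, e4⟩ := floor_add_mul y hy k n
        have h3 := hn (p (k + n) - p k - p n, q (k + n) - q k - q n) (by
          simp only [Finset.mem_product, Finset.mem_range, p, q]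
          omega)
        dsimp only at h3
        rwa [show p n + (p (k + n) - p k - p n) = p (k + n) - p k by simp only [p]; omega,
          show q n + (q (k + n) - q k - q n) = q (k + n) - q k by simp only [q]; omega] at h3) M
    simpa [p, q, meanLpp] using h2
  have hlow : Tendsto (fun M : ℕ => (c' - ∫ w in B N, (D w + |c'|) ∂ν) -
      (N * ∫ w, (D w + |c'|) ∂ν) / (M : ℝ)) atTop
      (𝓝 ((c' - ∫ w in B N, (D w + |c'|) ∂ν) - 0)) :=
    tendsto_const_nhds.sub (tendsto_const_div_atTop_nhds_zero_nat _)
  have hle := le_of_tendsto_of_tendsto hlow hγ (by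
    filter_upwards [eventually_gt_atTop 0] with M hM
    have hM' : (0 : ℝ) < M := Nat.cast_pos.2 hM
    rw [le_div_iff₀ hM', sub_mul, div_mul_cancel₀ _ hM'.ne']
    linarith [hblock M])
  linarith

theorem ae_eventually_rayTime_le {γ : ℝ}
    (hγ : Tendsto (fun n : ℕ => meanLpp ν ⌊(n : ℝ) * x⌋₊ ⌊(n : ℝ) * y⌋₊ / n) atTop (𝓝 γ)) :
    ∀ᵐ w ∂ν, ∀ ε : ℝ, 0 < ε → ∀ᶠ n : ℕ in atTop, rayTime x y n w ≤ n * (γ + ε) := by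
  have h1 : ∀ k : ℕ, ∀ᵐ w ∂ν, ∀ᶠ n : ℕ in atTop,
      rayTime x y n w ≤ n * (γ + 1 / ((k : ℝ) + 1)) := by
    intro k
    have hk : (0 : ℝ) < 1 / ((k : ℝ) + 1) := by positivity
    rcases measure_rateSet_frequently hν hint hx hy (γ + 1 / ((k : ℝ) + 1)) with h | h
    · have h2 : ∀ᵐ w ∂ν, w ∉ rateSet (fun p => ∃ᶠ n in atTop, p n) x y (γ + 1 / ((k : ℝ) + 1)) :=
        measure_eq_zero_iff_ae_notMem.1 h
      filter_upwards [h2] with w hw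
      simp only [rateSet, Set.mem_ofPred_eq, not_forall, not_frequently, not_le] at hw
      obtain ⟨l, hl⟩ := hw
      filter_upwards [hl] with n hn
      have hl0 : (0 : ℝ) < 1 / ((l : ℝ) + 1) := by positivity
      exact hn.le.trans (mul_le_mul_of_nonneg_left (by linarith) n.cast_nonneg)
    · have := le_of_rateSet_frequently hν hint hx hy hγ h
      linarith
  filter_upwards [ae_all_iff.2 h1] with w hw ε hε
  obtain ⟨k, hk⟩ := exists_nat_one_div_lt hε
  filter_upwards [hw k] with n hn
  exact hn.trans (mul_le_mul_of_nonneg_left (by linarith) n.cast_nonneg)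

end Rate

/-! ### Convergence in mean -/

section Convergence

variable {ν : Measure (ℕ × ℕ → ℝ)} [IsProbabilityMeasure ν] (hν : IsErgodicField ν)
  (hint : ∀ z, Integrable (fun w => w z) ν) {x y : ℝ} (hx : 0 < x) (hy : 0 < y)

include hint hx hy

/-- The positive part of the deviation from the growth rate tends to zero in mean: the truncated
weights contribute a bounded quantity, the excess is uniformly small in mean. -/
theorem tendsto_integral_rayTime_sub_pos (hS : HasSmallExcess ν) {γ : ℝ}
    (hup : ∀ᵐ w ∂ν, ∀ ε : ℝ, 0 < ε → ∀ᶠ n : ℕ in atTop, rayTime x y n w ≤ n * (γ + ε)) :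
    Tendsto (fun n : ℕ => ∫ w, max ((n : ℝ)⁻¹ * rayTime x y n w - γ) 0 ∂ν) atTop (𝓝 0) := by
  have hTi : ∀ n, Integrable (rayTime x y n) ν := fun n => integrable_lpp hint _ _
  have hgm : ∀ n : ℕ, Measurable fun w => max ((n : ℝ)⁻¹ * rayTime x y n w - γ) 0 := fun n =>
    (((measurable_rayTime x y n).const_mul _).sub_const _).max measurable_const
  have hgi : ∀ n : ℕ, Integrable (fun w => max ((n : ℝ)⁻¹ * rayTime x y n w - γ) 0) ν := fun n =>
    (((hTi n).const_mul _).sub (integrable_const _)).sup (integrable_const 0)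
  rw [tendsto_order]
  refine ⟨fun a ha => Eventually.of_forall fun n =>
    ha.trans_le (integral_nonneg fun w => le_max_right _ _), fun ε hε => ?_⟩
  obtain ⟨K, hK0, hK⟩ := hS (ε / 2 / (x + y + 1)) (by positivity)
  set C := K * (x + y) + |γ| with hC
  have hC0 : 0 ≤ C := by positivity
  have hmin : Tendsto (fun n : ℕ =>
      ∫ w, min (max ((n : ℝ)⁻¹ * rayTime x y n w - γ) 0) C ∂ν) atTop (𝓝 (∫ _, (0 : ℝ) ∂ν)) := by
    refine tendsto_integral_of_dominated_convergence (fun _ => C)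
      (fun n => ((hgm n).min measurable_const).aestronglyMeasurable) (integrable_const C)
      (fun n => Eventually.of_forall fun w => ?_) ?_
    · rw [Real.norm_of_nonneg (le_min (le_max_right _ _) hC0)]
      exact min_le_right _ _
    · filter_upwards [hup] with w hw
      rw [tendsto_order]
      refine ⟨fun a ha => Eventually.of_forall fun n =>
        ha.trans_le (le_min (le_max_right _ _) hC0), fun δ hδ => ?_⟩
      filter_upwards [hw (δ / 2) (by positivity), eventually_gt_atTop 0] with n hn hn0
      have hn0' : (0 : ℝ) < n := Nat.cast_pos.2 hn0
      refine (min_le_left _ _).trans_lt (max_lt ?_ hδ)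
      have : (n : ℝ)⁻¹ * rayTime x y n w ≤ γ + δ / 2 := by
        rw [inv_mul_le_iff₀ hn0']
        exact hn
      linarith
  rw [integral_zero] at hmin
  filter_upwards [hmin.eventually (gt_mem_nhds (by positivity : 0 < ε / 2)),
    eventually_ge_atTop 1] with n hn hn1
  have hn1' : (1 : ℝ) ≤ n := Nat.one_le_cast.2 hn1
  have hn0 : (0 : ℝ) < n := by linarith
  set i := ⌊(n : ℝ) * x⌋₊ with hi
  set j := ⌊(n : ℝ) * y⌋₊ with hj
  have hix : (i : ℝ) ≤ n * x := Nat.floor_le (by positivity)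
  have hjy : (j : ℝ) ≤ n * y := Nat.floor_le (by positivity)
  have hE := (integrable_lpp_excess hint K i j).const_mul (n : ℝ)⁻¹
  have hpt : ∀ w, max ((n : ℝ)⁻¹ * rayTime x y n w - γ) 0 ≤
      min (max ((n : ℝ)⁻¹ * rayTime x y n w - γ) 0) C +
        (n : ℝ)⁻¹ * lpp (fun z => max (w z - K) 0) i j := by
    intro w
    have h0 : 0 ≤ (n : ℝ)⁻¹ * lpp (fun z => max (w z - K) 0) i j :=
      mul_nonneg (inv_nonneg.2 hn0.le) (lpp_nonneg (fun z => le_max_right _ _) i j)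
    have h1 : rayTime x y n w ≤ K * (i + j) + lpp (fun z => max (w z - K) 0) i j := by
      refine (lpp_le_lpp_add w (fun z => min (w z) K)
        (u := fun z => max (w z - K) 0) (fun z => ?_) i j).trans
        (add_le_add_left (lpp_le_of_le (fun z => min_le_right _ _) i j) _)
      rcases le_total (w z) K with h | h <;> simp [h]
    have h2 : (n : ℝ)⁻¹ * rayTime x y n w ≤
        K * (x + y) + (n : ℝ)⁻¹ * lpp (fun z => max (w z - K) 0) i j := by
      have h3 : (n : ℝ)⁻¹ * (K * (i + j)) ≤ K * (x + y) := by
        rw [inv_mul_le_iff₀ hn0]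
        have := mul_le_mul_of_nonneg_left (add_le_add hix hjy) hK0
        linarith
      have h4 := mul_le_mul_of_nonneg_left h1 (inv_nonneg.2 hn0.le)
      rw [mul_add] at h4
      linarith
    rcases le_total (max ((n : ℝ)⁻¹ * rayTime x y n w - γ) 0) C with h | h
    · rw [min_eq_left h]
      linarith
    · rw [min_eq_right h]
      refine max_le ?_ (by linarith)
      linarith [neg_abs_le γ]
  have hmi : Integrable (fun w => min (max ((n : ℝ)⁻¹ * rayTime x y n w - γ) 0) C) ν :=
    (hgi n).inf (integrable_const C)
  refine (integral_mono (hgi n) (hmi.add hE) hpt).trans_lt ?_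
  simp only [Pi.add_apply]
  rw [integral_add hmi hE, integral_const_mul]
  have h5 : (n : ℝ)⁻¹ * ∫ w, lpp (fun z => max (w z - K) 0) i j ∂ν ≤ ε / 2 := by
    rw [inv_mul_le_iff₀ hn0]
    refine (hK i j).trans ?_
    have h6 : (i : ℝ) + j + 1 ≤ n * (x + y + 1) := by linarith
    calc ε / 2 / (x + y + 1) * (i + j + 1) ≤ ε / 2 / (x + y + 1) * (n * (x + y + 1)) :=
          mul_le_mul_of_nonneg_left h6 (by positivity)
      _ = n * (ε / 2) := by
          field_simp
  linarith

theorem tendsto_integral_abs_rayTime_sub (hS : HasSmallExcess ν) {γ : ℝ}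
    (hγ : Tendsto (fun n : ℕ => meanLpp ν ⌊(n : ℝ) * x⌋₊ ⌊(n : ℝ) * y⌋₊ / n) atTop (𝓝 γ))
    (hup : ∀ᵐ w ∂ν, ∀ ε : ℝ, 0 < ε → ∀ᶠ n : ℕ in atTop, rayTime x y n w ≤ n * (γ + ε)) :
    Tendsto (fun n : ℕ => ∫ w, |(n : ℝ)⁻¹ * rayTime x y n w - γ| ∂ν) atTop (𝓝 0) := by
  have hgi : ∀ n : ℕ, Integrable (fun w => (n : ℝ)⁻¹ * rayTime x y n w) ν := fun n =>
    (integrable_lpp hint _ _).const_mul _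
  have h1 := (tendsto_integral_rayTime_sub_pos hint hx hy hS hup).const_mul 2
  have h2 := h1.sub (hγ.sub_const γ)
  rw [mul_zero, sub_self, sub_zero] at h2
  refine h2.congr fun n => ?_
  have habs : ∀ a : ℝ, |a| = 2 * max a 0 - a := fun a => by
    rcases le_total a 0 with h | h
    · rw [abs_of_nonpos h, max_eq_right h]; ring
    · rw [abs_of_nonneg h, max_eq_left h]; ring
  simp only [habs]
  rw [integral_sub, integral_const_mul, integral_sub (hgi n) (integrable_const _),
    integral_const_mul]
  · simp only [integral_const, probReal_univ, one_smul, meanLpp, rayTime]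
    ring
  · exact (((hgi n).sub (integrable_const _)).sup (integrable_const 0)).const_mul 2
  · exact (hgi n).sub (integrable_const _)

/-! ### The lower bound -/

include hν

/-- By convergence in mean, blocks of a large fixed length `m` fall short of slope `γ - ε` only by
a small amount in mean; the maximal inequality for the total shortfall then gives growth at rate
almost `γ` with positive probability, and the zero-one law gives it almost surely. -/
theorem ae_eventually_le_rayTime {γ : ℝ}
    (hL1 : Tendsto (fun n : ℕ => ∫ w, |(n : ℝ)⁻¹ * rayTime x y n w - γ| ∂ν) atTop (𝓝 0)) :
    ∀ᵐ w ∂ν, ∀ ε : ℝ, 0 < ε → ∀ᶠ n : ℕ in atTop, n * (γ - ε) ≤ rayTime x y n w := by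
  have hTi : ∀ n, Integrable (rayTime x y n) ν := fun n => integrable_lpp hint _ _
  have main : ∀ ε : ℝ, 0 < ε →
      ν (rateSet (fun p => ∀ᶠ n in atTop, p n) x y (γ - 5 * ε)) ≠ 0 := by
    intro ε hε
    set b := ∫ w, boxSum 2 w ∂ν with hb
    -- The block length.
    obtain ⟨m, hm1, hm2, hm3⟩ : ∃ m : ℕ, 1 ≤ m ∧
        ∫ w, |(m : ℝ)⁻¹ * rayTime x y m w - γ| ∂ν < ε / 16 ∧ 2 * b < m * (ε / 16) := by
      obtain ⟨m₀, hm₀⟩ := exists_nat_gt (2 * b / (ε / 16))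
      obtain ⟨m, h1, h2, h3⟩ := ((eventually_ge_atTop 1).and
        ((hL1.eventually (gt_mem_nhds (by positivity : 0 < ε / 16))).and
          (eventually_ge_atTop m₀))).exists
      refine ⟨m, h1, h2, ?_⟩
      rw [← div_lt_iff₀ (by positivity)]
      exact hm₀.trans_le (Nat.cast_le.2 h3)
    have hm0 : (0 : ℝ) < m := by
      have : (1 : ℝ) ≤ m := Nat.one_le_cast.2 hm1
      linarith
    -- A lower bound for the last-passage times over all blocks of length `m`.
    let V : (ℕ × ℕ → ℝ) → ℝ := fun w => rayTime x y m w -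
      2 * boxSum 2 (translate ⌊(m : ℝ) * x⌋₊ ⌊(m : ℝ) * y⌋₊ w)
    have hbox := hν.integrable_comp_translate ⌊(m : ℝ) * x⌋₊ ⌊(m : ℝ) * y⌋₊
      (integrable_boxSum hint 2)
    have hVm : Measurable V := (measurable_rayTime x y m).sub
      (((measurable_boxSum 2).comp (measurable_translate _ _)).const_mul 2)
    have hVi : Integrable V ν := (hTi m).sub (hbox.const_mul 2)
    let h : (ℕ × ℕ → ℝ) → ℝ := fun w => max (m * (γ - ε) - V w) 0
    have hhm : Measurable h := (hVm.const_sub _).max measurable_const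
    have hhi : Integrable h ν := ((integrable_const _).sub hVi).sup (integrable_const 0)
    have hh0 : ∀ w, 0 ≤ h w := fun w => le_max_right _ _
    have habs : Integrable (fun w => |(m : ℝ)⁻¹ * rayTime x y m w - γ|) ν :=
      (((hTi m).const_mul _).sub (integrable_const _)).abs
    have hhI : 4 * ∫ w, h w ∂ν < m * ε := by
      have h1 : ∀ w, h w ≤ m * |(m : ℝ)⁻¹ * rayTime x y m w - γ| +
          2 * boxSum 2 (translate ⌊(m : ℝ) * x⌋₊ ⌊(m : ℝ) * y⌋₊ w) := by
        intro w
        have h2 := boxSum_nonneg 2 (translate ⌊(m : ℝ) * x⌋₊ ⌊(m : ℝ) * y⌋₊ w)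
        refine max_le ?_ (by positivity)
        have h3 := mul_le_mul_of_nonneg_left
          (neg_abs_le ((m : ℝ)⁻¹ * rayTime x y m w - γ)) hm0.le
        rw [mul_sub, ← mul_assoc, mul_inv_cancel₀ hm0.ne', one_mul] at h3
        have h4 : 0 ≤ m * ε := by positivity
        simp only [V]
        linarith
      have h2 := integral_mono hhi ((habs.const_mul _).add (hbox.const_mul 2)) h1
      simp only [Pi.add_apply] at h2
      rw [integral_add (habs.const_mul _) (hbox.const_mul 2), integral_const_mul,
        integral_const_mul, hν.integral_comp_translate _ _ (measurable_boxSum 2)] at h2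
      have h3 := mul_lt_mul_of_pos_left hm2 hm0
      have h4 : 0 < m * ε := by positivity
      linarith
    have hpos := measure_forall_sum_lt_ne_zero hν (x := m * x) (y := m * y) (by positivity)
      (by positivity) hhm hhi hh0 hhI
    set K := ⌊(m : ℝ) * x⌋₊ + ⌊(m : ℝ) * y⌋₊ + 3 with hK
    have hae := hν.ae_eventually_comp_translate_le (integrable_boxSum hint K)
      (measurable_boxSum K) (boxSum_nonneg K) (fun n => ⌊((n / m * m : ℕ) : ℝ) * x⌋₊)
      (fun n => ⌊((n / m * m : ℕ) : ℝ) * y⌋₊)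
    refine fun hzero => hpos (measure_eq_zero_iff_ae_notMem.2 ?_)
    filter_upwards [hae, measure_eq_zero_iff_ae_notMem.1 hzero] with w hw hnot hmem
    refine hnot ?_
    have hblocks : ∀ n : ℕ, n * (m * (γ - ε)) - ∑ i ∈ Finset.range n,
        h (translate ⌊(i : ℝ) * (m * x)⌋₊ ⌊(i : ℝ) * (m * y)⌋₊ w) ≤ rayTime x y (n * m) w := by
      intro n
      induction n with
      | zero => simp [rayTime]
      | succ n ih =>
        have e1 : (n : ℝ) * (m * x) = ((n * m : ℕ) : ℝ) * x := by push_cast; ring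
        have e2 : (n : ℝ) * (m * y) = ((n * m : ℕ) : ℝ) * y := by push_cast; ring
        rw [Finset.sum_range_succ, e1, e2]
        set w' := translate ⌊((n * m : ℕ) : ℝ) * x⌋₊ ⌊((n * m : ℕ) : ℝ) * y⌋₊ w with hw'
        obtain ⟨f1, f2⟩ := floor_add_mul x hx (n * m) m
        obtain ⟨f3, f4⟩ := floor_add_mul y hy (n * m) m
        have h1 := lpp_add_le w ⌊((n * m : ℕ) : ℝ) * x⌋₊ ⌊((n * m : ℕ) : ℝ) * y⌋₊
          (⌊((n * m + m : ℕ) : ℝ) * x⌋₊ - ⌊((n * m : ℕ) : ℝ) * x⌋₊)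
          (⌊((n * m + m : ℕ) : ℝ) * y⌋₊ - ⌊((n * m : ℕ) : ℝ) * y⌋₊)
        rw [Nat.add_sub_cancel' (by omega), Nat.add_sub_cancel' (by omega), ← hw'] at h1
        have h2 := lpp_sub_boxSum_le w' (K := 2) (a := ⌊(m : ℝ) * x⌋₊) (b := ⌊(m : ℝ) * y⌋₊)
          (i := ⌊((n * m + m : ℕ) : ℝ) * x⌋₊ - ⌊((n * m : ℕ) : ℝ) * x⌋₊)
          (j := ⌊((n * m + m : ℕ) : ℝ) * y⌋₊ - ⌊((n * m : ℕ) : ℝ) * y⌋₊)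
          (by omega) (by omega) (by omega) (by omega)
        have h3 : m * (γ - ε) - V w' ≤ h w' := le_max_left _ _
        simp only [V, rayTime] at h3 ih ⊢
        rw [show (n + 1) * m = n * m + m by ring]
        push_cast at *
        linarith
    have hmult : ∀ n : ℕ, ((n * m : ℕ) : ℝ) * (γ - 2 * ε) ≤ rayTime x y (n * m) w := by
      intro n
      refine le_trans ?_ (hblocks n)
      rcases Nat.eq_zero_or_pos n with rfl | hn
      · simp
      · have := hmem n hn
        push_cast
        linarith
    have hend : ∀ᶠ n : ℕ in atTop, (n : ℝ) * (γ - 5 * ε) ≤ rayTime x y n w := by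
      obtain ⟨n₀, hn₀⟩ := exists_nat_gt (m * |γ - 2 * ε| / ε)
      rw [div_lt_iff₀ hε] at hn₀
      filter_upwards [hw ε hε, eventually_ge_atTop n₀] with n hn hnn
      have hdm : n / m * m + n % m = n := by rw [mul_comm]; exact Nat.div_add_mod n m
      have hmod : n % m < m := Nat.mod_lt n hm1
      obtain ⟨f1, f2⟩ := floor_add_mul x hx (n / m * m) (n % m)
      obtain ⟨f3, f4⟩ := floor_add_mul y hy (n / m * m) (n % m)
      have f5 := floor_mul_mono x hx hmod.le
      have f6 := floor_mul_mono y hy hmod.le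
      rw [hdm] at f1 f2 f3 f4
      have h1 := lpp_sub_boxSum_le w (K := K) (a := ⌊((n / m * m : ℕ) : ℝ) * x⌋₊)
        (b := ⌊((n / m * m : ℕ) : ℝ) * y⌋₊) (i := ⌊(n : ℝ) * x⌋₊) (j := ⌊(n : ℝ) * y⌋₊)
        (by omega) (by omega) (by omega) (by omega)
      have h2 := hmult (n / m)
      have h3 : (n : ℝ) = ((n / m * m : ℕ) : ℝ) + ((n % m : ℕ) : ℝ) := by
        rw [← Nat.cast_add, hdm]
      have h4 : ((n % m : ℕ) : ℝ) * (γ - 2 * ε) ≤ m * |γ - 2 * ε| :=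
        (mul_le_mul_of_nonneg_left (le_abs_self _) (Nat.cast_nonneg _)).trans
          (mul_le_mul_of_nonneg_right (Nat.cast_le.2 hmod.le) (abs_nonneg _))
      have h5 : (n₀ : ℝ) * ε ≤ n * ε :=
        mul_le_mul_of_nonneg_right (Nat.cast_le.2 hnn) hε.le
      have h6 : (n : ℝ) * (γ - 2 * ε) = ((n / m * m : ℕ) : ℝ) * (γ - 2 * ε) +
          ((n % m : ℕ) : ℝ) * (γ - 2 * ε) := by
        rw [← add_mul, ← h3]
      simp only [rayTime] at h2 ⊢
      linarith
    intro k
    filter_upwards [hend] with n hn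
    refine le_trans (mul_le_mul_of_nonneg_left ?_ n.cast_nonneg) hn
    have : (0 : ℝ) ≤ 1 / ((k : ℝ) + 1) := by positivity
    linarith
  have h1 : ∀ k : ℕ, ∀ᵐ w ∂ν, ∀ᶠ n : ℕ in atTop,
      (n : ℝ) * (γ - 6 * (1 / ((k : ℝ) + 1))) ≤ rayTime x y n w := by
    intro k
    have hk : (0 : ℝ) < 1 / ((k : ℝ) + 1) := by positivity
    have hone := (measure_rateSet_eventually hν hint hx hy
      (γ - 5 * (1 / ((k : ℝ) + 1)))).resolve_left (main _ hk)
    have hmem : ∀ᵐ w ∂ν,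
        w ∈ rateSet (fun p => ∀ᶠ n in atTop, p n) x y (γ - 5 * (1 / ((k : ℝ) + 1))) :=
      (prob_compl_eq_zero_iff (measurableSet_rateSet_eventually x y _)).2 hone
    filter_upwards [hmem] with w hw
    filter_upwards [hw k] with n hn
    refine le_trans (mul_le_mul_of_nonneg_left ?_ n.cast_nonneg) hn
    linarith
  filter_upwards [ae_all_iff.2 h1] with w hw ε hε
  obtain ⟨k, hk⟩ := exists_nat_one_div_lt (by positivity : 0 < ε / 6)
  filter_upwards [hw k] with n hn
  exact le_trans (mul_le_mul_of_nonneg_left (by linarith) n.cast_nonneg) hn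

/-- The law of large numbers along a ray, with the growth rate of the means as the limit. -/
theorem exists_growth_rate (hS : HasSmallExcess ν) :
    ∃ γ : ℝ,
      Tendsto (fun n : ℕ => meanLpp ν ⌊(n : ℝ) * x⌋₊ ⌊(n : ℝ) * y⌋₊ / n) atTop (𝓝 γ) ∧
      (∀ᵐ w ∂ν, Tendsto (fun n : ℕ => (n : ℝ)⁻¹ * rayTime x y n w) atTop (𝓝 γ)) ∧
      Tendsto (fun n : ℕ => ∫ w, |(n : ℝ)⁻¹ * rayTime x y n w - γ| ∂ν) atTop (𝓝 0) := by
  obtain ⟨γ, hγ⟩ := exists_tendsto_meanLpp_ray hν hint hS hx hy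
  have hup := ae_eventually_rayTime_le hν hint hx hy hγ
  have hL1 := tendsto_integral_abs_rayTime_sub hint hx hy hS hγ hup
  refine ⟨γ, hγ, ?_, hL1⟩
  filter_upwards [hup, ae_eventually_le_rayTime hν hint hx hy hL1] with w h1 h2
  rw [tendsto_order]
  constructor
  · intro a ha
    filter_upwards [h2 ((γ - a) / 2) (by linarith), eventually_gt_atTop 0] with n hn hn0
    have hn0' : (0 : ℝ) < n := Nat.cast_pos.2 hn0
    rw [lt_inv_mul_iff₀ hn0']
    refine lt_of_lt_of_le (mul_lt_mul_of_pos_left ?_ hn0') hn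
    linarith
  · intro a ha
    filter_upwards [h1 ((a - γ) / 2) (by linarith), eventually_gt_atTop 0] with n hn hn0
    have hn0' : (0 : ℝ) < n := Nat.cast_pos.2 hn0
    rw [inv_mul_lt_iff₀ hn0']
    refine lt_of_le_of_lt hn (mul_lt_mul_of_pos_left ?_ hn0')
    linarith

end Convergence

/-! ### The shape function -/

section Shape

variable {ν : Measure (ℕ × ℕ → ℝ)} (hν : IsErgodicField ν)
  (hint : ∀ z, Integrable (fun w => w z) ν) {Ψ : ℝ × ℝ → ℝ}
  (hΨ : ∀ x y : ℝ, 0 < x → 0 < y → Tendsto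
    (fun n : ℕ => meanLpp ν ⌊(n : ℝ) * x⌋₊ ⌊(n : ℝ) * y⌋₊ / n) atTop (𝓝 (Ψ (x, y))))

include hν hint hΨ

/-- For the homogeneous limit, superadditivity is concavity. -/
theorem shape_superadditive {x y x' y' : ℝ} (hx : 0 < x) (hy : 0 < y) (hx' : 0 < x')
    (hy' : 0 < y') : Ψ (x, y) + Ψ (x', y') ≤ Ψ (x + x', y + y') := by
  have hlim := ((hΨ x y hx hy).add (hΨ x' y' hx' hy')).sub
    (tendsto_const_div_atTop_nhds_zero_nat (2 * ∫ w, boxSum 2 w ∂ν))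
  rw [sub_zero] at hlim
  refine le_of_tendsto_of_tendsto' hlim (hΨ (x + x') (y + y') (by linarith) (by linarith))
    fun n => ?_
  rw [← add_div, ← sub_div]
  refine div_le_div_of_nonneg_right ?_ n.cast_nonneg
  have hfloor : ∀ a b : ℝ, 0 ≤ a → 0 ≤ b → ⌊a⌋₊ + ⌊b⌋₊ ≤ ⌊a + b⌋₊ ∧ ⌊a + b⌋₊ < ⌊a⌋₊ + ⌊b⌋₊ + 2 := by
    intro a b ha hb
    constructor
    · refine Nat.le_floor ?_
      push_cast
      linarith [Nat.floor_le ha, Nat.floor_le hb]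
    · rw [Nat.floor_lt (by linarith)]
      push_cast
      linarith [Nat.lt_floor_add_one a, Nat.lt_floor_add_one b]
  obtain ⟨h1, h2⟩ := hfloor (n * x) (n * x') (by positivity) (by positivity)
  obtain ⟨h3, h4⟩ := hfloor (n * y) (n * y') (by positivity) (by positivity)
  rw [mul_add, mul_add]
  have h5 := meanLpp_add_le hν hint ⌊(n : ℝ) * x⌋₊ ⌊(n : ℝ) * y⌋₊ ⌊(n : ℝ) * x'⌋₊ ⌊(n : ℝ) * y'⌋₊
  have h6 := meanLpp_sub_le hν hint (K := 2) h1 h3 h2 h4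
  linarith

theorem mul_shape_le {c x y : ℝ} (hc : 0 < c) (hx : 0 < x) (hy : 0 < y) :
    c * Ψ (x, y) ≤ Ψ (c * x, c * y) := by
  set K := ⌊x⌋₊ + ⌊y⌋₊ + 2 with hK
  -- The index `⌊c n⌋` on the ray through `(x, y)` is compared with `n` on the dilated ray.
  have hk : Tendsto (fun n : ℕ => ⌊c * (n : ℝ)⌋₊) atTop atTop :=
    tendsto_nat_floor_atTop.comp (tendsto_natCast_atTop_atTop.const_mul_atTop hc)
  have hkn : Tendsto (fun n : ℕ => (⌊c * (n : ℝ)⌋₊ : ℝ) / n) atTop (𝓝 c) :=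
    (tendsto_nat_floor_mul_div_atTop hc.le).comp tendsto_natCast_atTop_atTop
  have hlim := (hkn.mul ((hΨ x y hx hy).comp hk)).sub
    (tendsto_const_div_atTop_nhds_zero_nat (2 * ∫ w, boxSum K w ∂ν))
  rw [sub_zero] at hlim
  refine le_of_tendsto_of_tendsto hlim (hΨ (c * x) (c * y) (by positivity) (by positivity)) ?_
  filter_upwards [hk.eventually_gt_atTop 0] with n hn
  have hn' : (0 : ℝ) < ⌊c * (n : ℝ)⌋₊ := Nat.cast_pos.2 hn
  have hcn : 0 ≤ c * (n : ℝ) := by positivity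
  have hfloor : ∀ u : ℝ, 0 < u → ⌊(⌊c * (n : ℝ)⌋₊ : ℝ) * u⌋₊ ≤ ⌊(n : ℝ) * (c * u)⌋₊ ∧
      ⌊(n : ℝ) * (c * u)⌋₊ < ⌊(⌊c * (n : ℝ)⌋₊ : ℝ) * u⌋₊ + (⌊u⌋₊ + 2) := by
    intro u hu
    have h1 := mul_le_mul_of_nonneg_right (Nat.floor_le hcn) hu.le
    have h2 := mul_lt_mul_of_pos_right (Nat.lt_floor_add_one (c * (n : ℝ))) hu
    constructor
    · exact Nat.floor_mono (by linarith)
    · rw [Nat.floor_lt (by positivity)]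
      push_cast
      linarith [Nat.lt_floor_add_one u, Nat.lt_floor_add_one ((⌊c * (n : ℝ)⌋₊ : ℝ) * u)]
  obtain ⟨h1, h2⟩ := hfloor x hx
  obtain ⟨h3, h4⟩ := hfloor y hy
  have h5 := meanLpp_sub_le hν hint (K := K) h1 h3 (by omega) (by omega)
  have h6 : (⌊c * (n : ℝ)⌋₊ : ℝ) / n * (meanLpp ν ⌊(⌊c * (n : ℝ)⌋₊ : ℝ) * x⌋₊
      ⌊(⌊c * (n : ℝ)⌋₊ : ℝ) * y⌋₊ / ⌊c * (n : ℝ)⌋₊) =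
      meanLpp ν ⌊(⌊c * (n : ℝ)⌋₊ : ℝ) * x⌋₊ ⌊(⌊c * (n : ℝ)⌋₊ : ℝ) * y⌋₊ / n := by
    rw [div_mul_div_comm, mul_comm (n : ℝ), mul_div_mul_left _ _ hn'.ne']
  simp only [Function.comp_apply]
  rw [h6, ← sub_div]
  exact div_le_div_of_nonneg_right h5 n.cast_nonneg

theorem shape_mul {c x y : ℝ} (hc : 0 < c) (hx : 0 < x) (hy : 0 < y) :
    Ψ (c * x, c * y) = c * Ψ (x, y) := by
  refine le_antisymm ?_ (mul_shape_le hν hint hΨ hc hx hy)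
  have h := mul_shape_le hν hint hΨ (inv_pos.2 hc) (mul_pos hc hx) (mul_pos hc hy)
  rwa [inv_mul_cancel_left₀ hc.ne', inv_mul_cancel_left₀ hc.ne', inv_mul_le_iff₀ hc] at h

theorem shape_concaveOn : ConcaveOn ℝ (Set.Ioi (0 : ℝ) ×ˢ Set.Ioi (0 : ℝ)) Ψ := by
  refine ⟨(convex_Ioi 0).prod (convex_Ioi 0), ?_⟩
  rintro ⟨x, y⟩ ⟨hx, hy⟩ ⟨x', y'⟩ ⟨hx', hy'⟩ a b ha hb hab
  simp only [Set.mem_Ioi] at hx hy hx' hy'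
  rcases ha.eq_or_lt with rfl | ha
  · obtain rfl : b = 1 := by linarith
    simp
  rcases hb.eq_or_lt with rfl | hb
  · obtain rfl : a = 1 := by linarith
    simp
  simp only [Prod.smul_mk, Prod.mk_add_mk, smul_eq_mul]
  rw [← shape_mul hν hint hΨ ha hx hy, ← shape_mul hν hint hΨ hb hx' hy']
  exact shape_superadditive hν hint hΨ (mul_pos ha hx) (mul_pos ha hy) (mul_pos hb hx')
    (mul_pos hb hy')

end Shape

end LastPassage

theorem mainTheorem7
    (P : Measure LastPassage.Env) [IsProbabilityMeasure P]
    (hP : Ergodic LastPassage.shift P)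
    {Ω : Type*} [MeasurableSpace Ω] (μ : Measure Ω) [IsProbabilityMeasure μ]
    (F : Ω → LastPassage.Env) (X : ℕ × ℕ → Ω → ℝ)
    (hX : LastPassage.IsModel P μ F X)
    (hmom : ∀ z, Integrable (X z) μ)
    (htail1 : ∫⁻ u in Set.Ioi (0 : ℝ),
      ENNReal.ofReal (Real.sqrt (1 - ∫ G, cdf (G 0 : Measure ℝ) u ∂P)) < ⊤)
    (htail2 : ∫⁻ u in Set.Ioi (0 : ℝ),
      ENNReal.ofReal (essSup (fun G : LastPassage.Env => 1 - cdf (G 0 : Measure ℝ) u) P) < ⊤) :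
    ∃ Ψ : ℝ × ℝ → ℝ,
      (∀ x y : ℝ, 0 < x → 0 < y →
        (∀ᵐ ω ∂μ, Tendsto (fun n : ℕ => (n : ℝ)⁻¹ *
            LastPassage.passageTime (fun z => X z ω) (0, 0) (⌊(n : ℝ) * x⌋₊, ⌊(n : ℝ) * y⌋₊))
          atTop (𝓝 (Ψ (x, y)))) ∧
        (∀ n : ℕ, Integrable (fun ω =>
            LastPassage.passageTime (fun z => X z ω) (0, 0) (⌊(n : ℝ) * x⌋₊, ⌊(n : ℝ) * y⌋₊)) μ) ∧
        Tendsto (fun n : ℕ => ∫ ω, |(n : ℝ)⁻¹ *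
            LastPassage.passageTime (fun z => X z ω) (0, 0) (⌊(n : ℝ) * x⌋₊, ⌊(n : ℝ) * y⌋₊)
              - Ψ (x, y)| ∂μ) atTop (𝓝 0)) ∧
      (∀ c x y : ℝ, 0 < c → 0 < x → 0 < y → Ψ (c * x, c * y) = c * Ψ (x, y)) ∧
      ConcaveOn ℝ (Set.Ioi (0 : ℝ) ×ˢ Set.Ioi (0 : ℝ)) Ψ ∧
      ContinuousOn Ψ (Set.Ioi (0 : ℝ) ×ˢ Set.Ioi (0 : ℝ)) := by
  have hXm : Measurable fun ω z => X z ω := measurable_pi_lambda _ hX.measurable_weight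
  have hmap := hX.map_weight_eq
  have hν := LastPassage.isErgodicField_weightLaw hP
  have hint : ∀ z, Integrable (fun w => w z) (LastPassage.weightLaw P) := fun z => by
    rw [← hmap, integrable_map_measure (measurable_pi_apply z).aestronglyMeasurable
      hXm.aemeasurable]
    exact hmom z
  have hS := LastPassage.hasSmallExcess_weightLaw hP.toMeasurePreserving htail1 htail2
  have hcore := fun (x y : ℝ) (hx : 0 < x) (hy : 0 < y) =>
    LastPassage.exists_growth_rate hν hint hx hy hS
  choose! ψ hψ using hcore
  have hΨ : ∀ x y : ℝ, 0 < x → 0 < y → Tendsto (fun n : ℕ =>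
      LastPassage.meanLpp (LastPassage.weightLaw P) ⌊(n : ℝ) * x⌋₊ ⌊(n : ℝ) * y⌋₊ / n) atTop
      (𝓝 ((fun p : ℝ × ℝ => ψ p.1 p.2) (x, y))) := fun x y hx hy => (hψ x y hx hy).1
  have hconc := LastPassage.shape_concaveOn (Ψ := fun p => ψ p.1 p.2) hν hint hΨ
  refine ⟨fun p => ψ p.1 p.2, fun x y hx hy => ?_,
    fun c x y hc hx hy => LastPassage.shape_mul (Ψ := fun p => ψ p.1 p.2) hν hint hΨ hc hx hy,
    hconc,
    hconc.continuousOn (isOpen_Ioi.prod isOpen_Ioi)⟩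
  obtain ⟨-, has, hL1⟩ := hψ x y hx hy
  simp only [LastPassage.passageTime_eq_lpp]
  rw [← hmap] at has hL1 hint
  refine ⟨ae_of_ae_map hXm.aemeasurable has, fun n => ?_, hL1.congr fun n => ?_⟩
  · exact (LastPassage.integrable_lpp hint _ _).comp_measurable hXm
  · exact integral_map hXm.aemeasurable
      ((((LastPassage.measurable_rayTime x y n).const_mul _).sub_const _).abs).aestronglyMeasurable
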